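/- Let $S$ be a densely defined nonnegative symmetric operator in a complex Hilbert space $H$, and let $\tilde S_0,\tilde S_1$ be nonnegative selfadjoint extensions of $S$ with $\operatorname{dom}\tilde S_0\cap\operatorname{dom}\tilde S_1=\operatorname{dom}S$ such that the closed form $\tilde S_0[\cdot,\cdot]$ associated with $\tilde S_0$ is a (closed) restriction of the closed form $\tilde S_1[\cdot,\cdot]$ associated with $\tilde S_1$; write $\mathcal D[\tilde S_k]$ for the form domains. Regard $\mathcal D[\tilde S_1]$ as a Hilbert space with the inner product $\tilde S_1[u,v]+(u,v)$, put $\mathcal L=\operatorname{dom}\tilde S_0\dotplus(\mathcal D[\tilde S_1]\ominus\mathcal D[\tilde S_0])$ (orthogonal complement in $\mathcal D[\tilde S_1]$), $\mathfrak N_z=H\ominus\operatorname{ran}(S-\bar z I)$, $\mathfrak N=\mathfrak N_{-1}$, and $\tilde B_k=-I+2(I+\tilde S_k)^{-1}$, $k=0,1$. Let $\{\mathcal H,\Gamma_0,\Gamma_1\}$ be a boundary triplet for $\{\tilde S_0,\tilde S_1\}$: $\mathcal H$ is a Hilbert space, $\Gamma_0:\mathcal D[\tilde S_1]\to\mathcal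 H$ is linear, continuous and surjective with $\ker\Gamma_0=\mathcal D[\tilde S_0]$, and $\Gamma_1:\mathcal L\to\mathcal H$ is linear with $\tilde S_1[u,v]=(S^*u,v)-(\Gamma_1u,\Gamma_0v)_{\mathcal H}$ for all $u\in\mathcal L$, $v\in\mathcal D[\tilde S_1]$. Then for every $z\in\mathbb C\setminus[0,\infty)$ the map $\Gamma_0\restriction(\mathfrak N_z\cap\mathcal L)$ is a bijection onto $\mathcal H$; let $\Gamma_0(z)$ be its inverse. The Weyl function $M(z)=\Gamma_1\Gamma_0(z)$ is a bounded operator in $\mathcal H$, there is a linear homeomorphism $X_0$ from $\mathcal H$ onto $\mathfrak N$ with $\Gamma_0(-1)=(\tilde B_1-\tilde B_0)^{1/2}X_0$, and for every such $X_0$ $$M(z)=-2X_0^*\Big(I+(\tilde B_1-\tilde B_0)^{1/2}\Big(\tilde B_0-\tfrac{1-z}{1+z}I\Big)^{-1}(\tilde B_1-\tilde B_0)^{1/2}\Big)X_0=-2X_0^*\tilde Q_0\Big(\tfrac{1-z}{1+z}\Big)X_0$$ for $z\in\mathbb C\setminus[0,\infty)$, $z\ne-1$, where $\tilde Q_0(\lambda)=\big[(\tilde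 B_1-\tilde B_0)^{1/2}(\tilde B_0-\lambda I)^{-1}(\tilde B_1-\tilde B_0)^{1/2}+I\big]\restriction\mathfrak N$, while $M(-1)=-2X_0^*X_0$ (the same formula with $\tilde Q_0(\infty)=I$). If, in addition, $\tilde S_0\cap\tilde S_1=S$ and $\inf\{\tilde S_1[u-\varphi]:\varphi\in\mathcal D[\tilde S_0]\}=0$ for all $u\in\mathcal D[\tilde S_1]$, then $M$ belongs to the class $\mathcal S_F(\mathcal H)$ of Herglotz–Nevanlinna functions with values in the bounded operators on $\mathcal H$, holomorphic on $\mathbb C\setminus[0,\infty)$, such that (1) $M(z)$ has a bounded everywhere defined inverse for all $z\in\mathbb C\setminus[0,\infty)$; (2) $M(x)\to0$ strongly as $x\uparrow0$; (3) $(M(x)g,g)\to-\infty$ as $x\downarrow-\infty$ for each $g\ne0$; (4) $x^{-1}M(x)\to0$ strongly as $x\downarrow-\infty$. -/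

import Mathlib

open Filter Topology
open scoped InnerProductSpace ComplexConjugate

noncomputable section

namespace NonnegTriplet

variable {H : Type*} [NormedAddCommGroup H] [InnerProductSpace ℂ H]

/-! ### Closed nonnegative sesquilinear forms

Mathlib convention: `t.val u v` and `⟪u, v⟫_ℂ` are antilinear in `u` and linear in `v`. -/

/-- A closed nonnegative sesquilinear form with domain `dom`. -/
structure ClosedForm (H : Type*) [NormedAddCommGroup H] [InnerProductSpace ℂ H] where
  dom : Submodule ℂ H
  val : dom →ₗ⋆[ℂ] dom →ₗ[ℂ] ℂ
  im_eq_zero : ∀ u, (val u u).im = 0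
  nonneg : ∀ u, 0 ≤ (val u u).re
  closed : ∀ (x : ℕ → dom) (u : H),
    Tendsto (fun n => (x n : H)) atTop (𝓝 u) →
    Tendsto (fun p : ℕ × ℕ => val (x p.1 - x p.2) (x p.1 - x p.2)) atTop (𝓝 0) →
    ∃ hu : u ∈ dom, Tendsto (fun n => val (x n - ⟨u, hu⟩) (x n - ⟨u, hu⟩)) atTop (𝓝 0)

/-- `t` is a (closed) restriction of `t'`. -/
structure ClosedForm.IsRestriction (t t' : ClosedForm H) : Prop where
  dom_le : t.dom ≤ t'.dom
  val_eq : ∀ u v : t.dom,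
    t'.val (Submodule.inclusion dom_le u) (Submodule.inclusion dom_le v) = t.val u v

/-- `t` is associated with the operator `T`: `dom T ⊆ dom t` and `t[u, v] = (T u, v)` for all
`u ∈ dom T`, `v ∈ dom t`. A nonnegative selfadjoint operator has exactly one associated closed
nonnegative form. -/
def ClosedForm.IsAssociated (t : ClosedForm H) (T : H →ₗ.[ℂ] H) : Prop :=
  ∃ hd : T.domain ≤ t.dom, ∀ (u : T.domain) (v : t.dom),
    t.val (Submodule.inclusion hd u) v = ⟪T u, (v : H)⟫_ℂ

/-! ### Nonnegative selfadjoint operators -/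

/-- A nonnegative selfadjoint (in general unbounded, automatically densely defined) operator. -/
structure NonnegSAOp (H : Type*) [NormedAddCommGroup H] [InnerProductSpace ℂ H]
    [CompleteSpace H] where
  op : H →ₗ.[ℂ] H
  selfAdjoint : IsSelfAdjoint op
  nonneg : ∀ u : op.domain, 0 ≤ (⟪op u, (u : H)⟫_ℂ).re

variable [CompleteSpace H]

namespace NonnegSAOp

variable (T : NonnegSAOp H)

theorem formalAdjoint : T.op.IsFormalAdjoint T.op := by
  have h := LinearPMap.adjoint_isFormalAdjoint T.selfAdjoint.dense_domain
  rwa [LinearPMap.isSelfAdjoint_def.mp T.selfAdjoint] at h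

theorem norm_le (u : T.op.domain) : ‖(u : H)‖ ≤ ‖T.op u + (u : H)‖ := by
  have h1 : ‖(u : H)‖ ^ 2 ≤ (⟪T.op u + (u : H), (u : H)⟫_ℂ).re := by
    rw [inner_add_left, Complex.add_re]
    have h3 : (⟪(u : H), (u : H)⟫_ℂ).re = ‖(u : H)‖ ^ 2 := inner_self_eq_norm_sq (𝕜 := ℂ) (u : H)
    have := T.nonneg u
    linarith
  have h2 : (⟪T.op u + (u : H), (u : H)⟫_ℂ).re ≤ ‖T.op u + (u : H)‖ * ‖(u : H)‖ :=
    (Complex.re_le_norm _).trans (norm_inner_le_norm _ _)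
  by_contra! hlt
  have := norm_nonneg (T.op u + (u : H))
  nlinarith

/-- `I + T` as a linear map on `dom T`. -/
def onePlus : T.op.domain →ₗ[ℂ] H := T.op.toFun + T.op.domain.subtype

theorem onePlus_apply (u : T.op.domain) : T.onePlus u = T.op u + (u : H) := rfl

theorem onePlus_injective : Function.Injective T.onePlus := by
  rw [← LinearMap.ker_eq_bot, LinearMap.ker_eq_bot']
  intro u hu
  have := T.norm_le u
  rw [← onePlus_apply, hu, norm_zero] at this
  exact Subtype.ext (norm_le_zero_iff.mp this)

theorem onePlus_isClosed_range : IsClosed (LinearMap.range T.onePlus : Set H) := by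
  rw [← isSeqClosed_iff_isClosed]
  intro f g hf hg
  choose u hu using hf
  have hc : CauchySeq (fun n => (u n : H)) := by
    have hfc := hg.cauchySeq
    rw [Metric.cauchySeq_iff'] at hfc ⊢
    intro ε hε
    obtain ⟨N, hN⟩ := hfc ε hε
    refine ⟨N, fun n hn => lt_of_le_of_lt ?_ (hN n hn)⟩
    have := T.norm_le (u n - u N)
    rw [← onePlus_apply, map_sub, hu, hu] at this
    simpa [dist_eq_norm] using this
  obtain ⟨w, hw⟩ := cauchySeq_tendsto_of_complete hc
  have hT : Tendsto (fun n => ((u n : H), T.op (u n))) atTop (𝓝 (w, g - w)) := by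
    refine hw.prodMk_nhds ?_
    have : (fun n => T.op (u n)) = fun n => f n - (u n : H) := by
      funext n
      rw [← hu n, onePlus_apply, add_sub_cancel_right]
    rw [this]
    exact hg.sub hw
  have hmem : (w, g - w) ∈ T.op.graph := by
    have hcl : IsClosed (T.op.graph : Set (H × H)) := T.selfAdjoint.isClosed
    exact hcl.mem_of_tendsto hT (Eventually.of_forall fun n => T.op.mem_graph (u n))
  obtain ⟨y, hy1, hy2⟩ := (LinearPMap.mem_graph_iff _).mp hmem
  refine ⟨y, ?_⟩
  rw [onePlus_apply, hy2, hy1]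
  simp

theorem onePlus_surjective : Function.Surjective T.onePlus := by
  rw [← LinearMap.range_eq_top]
  have : CompleteSpace (LinearMap.range T.onePlus) := T.onePlus_isClosed_range.completeSpace_coe
  rw [← Submodule.orthogonal_eq_bot_iff, Submodule.eq_bot_iff]
  intro v hv
  have h0 : ∀ w : T.op.domain, ⟪-v, (w : H)⟫_ℂ = ⟪v, T.op w⟫_ℂ := by
    intro w
    have := (Submodule.mem_orthogonal' _ v).mp hv (T.onePlus w) ⟨w, rfl⟩
    rw [onePlus_apply, inner_add_right] at this
    rw [inner_neg_left]
    linear_combination -this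
  have hvd : v ∈ T.op.adjoint.domain := T.op.mem_adjoint_domain_of_exists v ⟨-v, h0⟩
  have hva := LinearPMap.adjoint_apply_eq T.selfAdjoint.dense_domain ⟨v, hvd⟩ h0
  have hg : (v, -v) ∈ T.op.graph := by
    rw [← LinearPMap.isSelfAdjoint_def.mp T.selfAdjoint]
    exact (LinearPMap.mem_graph_iff _).mpr ⟨⟨v, hvd⟩, rfl, hva⟩
  obtain ⟨y, hy1, hy2⟩ := (LinearPMap.mem_graph_iff _).mp hg
  have : T.onePlus y = 0 := by
    rw [onePlus_apply, hy2, hy1]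
    simp
  have hy0 : y = 0 := T.onePlus_injective (this.trans (map_zero _).symm)
  have : v = (y : H) := hy1.symm
  rw [this, hy0]
  simp

/-- The bijection `I + T : dom T → H`. -/
def onePlusEquiv : T.op.domain ≃ₗ[ℂ] H :=
  LinearEquiv.ofBijective T.onePlus ⟨T.onePlus_injective, T.onePlus_surjective⟩

/-- The bounded operator `(I + T)⁻¹`. -/
def resolventOne : H →L[ℂ] H :=
  (T.op.domain.subtype ∘ₗ T.onePlusEquiv.symm.toLinearMap).mkContinuous 1 (fun f => by
    have h := T.norm_le (T.onePlusEquiv.symm f)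
    have h2 : T.op (T.onePlusEquiv.symm f) + (T.onePlusEquiv.symm f : H) = f :=
      T.onePlusEquiv.apply_symm_apply f
    rw [h2] at h
    simpa using h)

theorem resolventOne_apply (f : H) : T.resolventOne f = (T.onePlusEquiv.symm f : H) := rfl

theorem resolventOne_onePlus (u : T.op.domain) :
    T.resolventOne (T.op u + (u : H)) = (u : H) := by
  rw [resolventOne_apply]
  exact congrArg Subtype.val (T.onePlusEquiv.symm_apply_apply u)

theorem op_symm (f : H) :
    T.op (T.onePlusEquiv.symm f) + (T.onePlusEquiv.symm f : H) = f :=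
  T.onePlusEquiv.apply_symm_apply f

/-- The Cayley transform `B = (I - T)(I + T)⁻¹ = -I + 2 (I + T)⁻¹`. -/
def cayley : H →L[ℂ] H := -1 + (2 : ℂ) • T.resolventOne

theorem resolventOne_nonneg : 0 ≤ T.resolventOne := by
  rw [ContinuousLinearMap.nonneg_iff_isPositive, ContinuousLinearMap.isPositive_def']
  refine ⟨?_, fun f => ?_⟩
  · rw [ContinuousLinearMap.isSelfAdjoint_iff_isSymmetric]
    intro f g
    have hf := T.op_symm f
    have hg := T.op_symm g
    have hs := T.formalAdjoint (T.onePlusEquiv.symm f) (T.onePlusEquiv.symm g)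
    change ⟪(T.onePlusEquiv.symm f : H), g⟫_ℂ = ⟪f, (T.onePlusEquiv.symm g : H)⟫_ℂ
    conv_lhs => rw [← hg]
    conv_rhs => rw [← hf]
    rw [inner_add_left, inner_add_right, hs]
  · have hf := T.op_symm f
    have hn := T.nonneg (T.onePlusEquiv.symm f)
    change 0 ≤ (⟪(T.onePlusEquiv.symm f : H), f⟫_ℂ).re
    have h3 : (⟪(T.onePlusEquiv.symm f : H), (T.onePlusEquiv.symm f : H)⟫_ℂ).re
      = ‖(T.onePlusEquiv.symm f : H)‖ ^ 2 := inner_self_eq_norm_sq (𝕜 := ℂ) _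
    have h5 : ⟪(T.onePlusEquiv.symm f : H), f⟫_ℂ = ⟪(T.onePlusEquiv.symm f : H),
        T.op (T.onePlusEquiv.symm f) + (T.onePlusEquiv.symm f : H)⟫_ℂ := by rw [hf]
    rw [h5, inner_add_right, Complex.add_re, h3]
    have h4 : (⟪(T.onePlusEquiv.symm f : H), T.op (T.onePlusEquiv.symm f)⟫_ℂ).re
      = (⟪T.op (T.onePlusEquiv.symm f), (T.onePlusEquiv.symm f : H)⟫_ℂ).re :=
      inner_re_symm (𝕜 := ℂ) _ _
    rw [h4]
    positivity

theorem norm_resolventOne_apply_le (f : H) : ‖T.resolventOne f‖ ≤ ‖f‖ := by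
  have h := T.norm_le (T.onePlusEquiv.symm f)
  rwa [op_symm] at h

/-- The square root of `(I + T)⁻¹`. -/
def root : H →L[ℂ] H := CFC.sqrt T.resolventOne

theorem root_root (f : H) : T.root (T.root f) = T.resolventOne f := by
  have := CFC.sqrt_mul_sqrt_self T.resolventOne T.resolventOne_nonneg
  exact congrArg (fun A : H →L[ℂ] H => A f) this

theorem root_symm (f g : H) : ⟪T.root f, g⟫_ℂ = ⟪f, T.root g⟫_ℂ := by
  have h : IsSelfAdjoint T.root := (CFC.sqrt_nonneg T.resolventOne).isSelfAdjoint
  exact (ContinuousLinearMap.isSelfAdjoint_iff_isSymmetric.mp h) f g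

theorem root_injective : Function.Injective (T.root : H →ₗ[ℂ] H) := by
  rw [← LinearMap.ker_eq_bot, LinearMap.ker_eq_bot']
  intro f hf
  have hf' : T.root f = 0 := hf
  have : T.resolventOne f = 0 := by rw [← root_root, hf', map_zero]
  have h2 : T.onePlusEquiv.symm f = 0 := Subtype.ext this
  simpa using h2

theorem norm_root_le (f : H) : ‖T.root f‖ ^ 2 ≤ ‖f‖ ^ 2 := by
  have h1 : (⟪T.root f, T.root f⟫_ℂ).re = ‖T.root f‖ ^ 2 := inner_self_eq_norm_sq (𝕜 := ℂ) _
  rw [← h1, root_symm, root_root]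
  calc (⟪f, T.resolventOne f⟫_ℂ).re ≤ ‖⟪f, T.resolventOne f⟫_ℂ‖ := Complex.re_le_norm _
    _ ≤ ‖f‖ * ‖T.resolventOne f‖ := norm_inner_le_norm _ _
    _ ≤ ‖f‖ * ‖f‖ := by gcongr; exact T.norm_resolventOne_apply_le f
    _ = ‖f‖ ^ 2 := (sq _).symm

/-- First representation theorem, existence of the closed form of `T`. -/
theorem exists_form : ∃ t : ClosedForm H, t.IsAssociated T.op := by
  let e : H ≃ₗ[ℂ] LinearMap.range (T.root : H →ₗ[ℂ] H) :=
    LinearEquiv.ofInjective _ T.root_injective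
  have he : ∀ f, ((e f : H)) = T.root f := fun f => rfl
  let D := LinearMap.range (T.root : H →ₗ[ℂ] H)
  let b : D →ₗ⋆[ℂ] D →ₗ[ℂ] ℂ :=
    LinearMap.mk₂'ₛₗ (starRingEnd ℂ) (RingHom.id ℂ)
      (fun u v : D => ⟪e.symm u, e.symm v⟫_ℂ - ⟪(u : H), (v : H)⟫_ℂ)
      (fun u u' v => by simp only [map_add, Submodule.coe_add, inner_add_left]; ring)
      (fun c u v => by
        simp only [map_smul, Submodule.coe_smul, inner_smul_left, smul_eq_mul]; ring)
      (fun u v v' => by simp only [map_add, Submodule.coe_add, inner_add_right]; ring)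
      (fun c u v => by
        simp only [map_smul, Submodule.coe_smul, inner_smul_right, smul_eq_mul, RingHom.id_apply]
        ring)
  have hb : ∀ u v : D, b u v = ⟪e.symm u, e.symm v⟫_ℂ - ⟪(u : H), (v : H)⟫_ℂ := fun _ _ => rfl
  have hq : ∀ u : D, b u u = ((‖e.symm u‖ ^ 2 - ‖(u : H)‖ ^ 2 : ℝ) : ℂ) := by
    intro u
    rw [hb, inner_self_eq_norm_sq_to_K, inner_self_eq_norm_sq_to_K]
    push_cast
    rfl
  have hu : ∀ u : D, ‖(u : H)‖ ^ 2 ≤ ‖e.symm u‖ ^ 2 := by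
    intro u
    have := T.norm_root_le (e.symm u)
    rwa [← he, e.apply_symm_apply] at this
  refine ⟨⟨D, b, fun u => by rw [hq, Complex.ofReal_im],
    fun u => by rw [hq, Complex.ofReal_re]; linarith [hu u], ?_⟩, ?_⟩
  · intro x u hx hxx
    have hxx' : Tendsto (fun p : ℕ × ℕ => ‖e.symm (x p.1) - e.symm (x p.2)‖ ^ 2
        - ‖(x p.1 : H) - x p.2‖ ^ 2) atTop (𝓝 0) := by
      have := (Complex.continuous_re.tendsto 0).comp hxx
      refine this.congr fun p => ?_
      simp only [Function.comp_apply]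
      rw [hq, Complex.ofReal_re, map_sub]
      rfl
    have hx2 : Tendsto (fun p : ℕ × ℕ => ‖(x p.1 : H) - x p.2‖ ^ 2) atTop (𝓝 0) := by
      have h1 : Tendsto (fun p : ℕ × ℕ => (x p.1 : H) - x p.2) atTop (𝓝 (u - u)) := by
        rw [← prod_atTop_atTop_eq]
        exact (hx.comp tendsto_fst).sub (hx.comp tendsto_snd)
      have := (h1.norm.pow 2)
      simpa using this
    have hs : Tendsto (fun p : ℕ × ℕ => ‖e.symm (x p.1) - e.symm (x p.2)‖ ^ 2) atTop (𝓝 0) := by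
      have := hxx'.add hx2
      simpa using this
    have hc : CauchySeq (fun n => e.symm (x n)) := by
      rw [cauchySeq_iff_tendsto_dist_atTop_0]
      have := (Real.continuous_sqrt.tendsto 0).comp hs
      simpa [Function.comp_def, dist_eq_norm, Real.sqrt_sq] using this
    obtain ⟨f, hf⟩ := cauchySeq_tendsto_of_complete hc
    have huf : T.root f = u := by
      refine tendsto_nhds_unique ((T.root.continuous.tendsto f).comp hf) ?_
      have : (T.root ∘ fun n => e.symm (x n)) = fun n => (x n : H) := by
        funext n
        change T.root (e.symm (x n)) = _
        rw [← he, e.apply_symm_apply]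
      rw [this]
      exact hx
    refine ⟨⟨f, huf⟩, ?_⟩
    have hef : e.symm ⟨u, ⟨f, huf⟩⟩ = f := by
      rw [LinearEquiv.symm_apply_eq]
      exact Subtype.ext huf.symm
    have h1 : Tendsto (fun n => ‖e.symm (x n) - f‖ ^ 2 - ‖(x n : H) - u‖ ^ 2) atTop (𝓝 0) := by
      have h1 := ((hf.sub_const f).norm.pow 2).sub ((hx.sub_const u).norm.pow 2)
      simpa using h1
    have h2 := (Complex.continuous_ofReal.tendsto 0).comp h1
    rw [Complex.ofReal_zero] at h2
    refine h2.congr fun n => ?_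
    rw [hq, map_sub, hef]
    rfl
  · have hTR : ∀ u : T.op.domain, T.root (T.root (T.op u + (u : H))) = u := fun u => by
      rw [root_root, resolventOne_onePlus]
    have hle : T.op.domain ≤ D := fun u hu =>
      LinearMap.mem_range.mpr ⟨T.root (T.op ⟨u, hu⟩ + u), hTR ⟨u, hu⟩⟩
    refine ⟨hle, fun u v => ?_⟩
    change b (Submodule.inclusion hle u) v = _
    have h1 : e.symm (Submodule.inclusion hle u) = T.root (T.op u + (u : H)) := by
      rw [LinearEquiv.symm_apply_eq]
      exact Subtype.ext (hTR u).symm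
    rw [hb, h1, root_symm, ← he, e.apply_symm_apply, inner_add_left]
    exact add_sub_cancel_right _ _

/-- The closed form `T[·,·]` associated with `T`; its domain is `D[T]`. -/
def form : ClosedForm H := T.exists_form.choose

theorem form_isAssociated : T.form.IsAssociated T.op := T.exists_form.choose_spec

theorem domain_le : T.op.domain ≤ T.form.dom := T.form_isAssociated.choose

theorem form_apply (u : T.op.domain) (v : T.form.dom) :
    T.form.val (Submodule.inclusion T.domain_le u) v = ⟪T.op u, (v : H)⟫_ℂ :=
  T.form_isAssociated.choose_spec u v

end NonnegSAOp

/-! ### Pairs of nonnegative selfadjoint extensions -/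

/-- The defect subspace `N_z = H ⊖ ran (S - z̄ I)`. -/
def defectSpace (S : H →ₗ.[ℂ] H) (z : ℂ) : Submodule ℂ H :=
  (LinearMap.range (S.toFun - (conj z) • S.domain.subtype))ᗮ

instance (S : H →ₗ.[ℂ] H) (z : ℂ) : CompleteSpace (defectSpace S z) :=
  inferInstanceAs (CompleteSpace ((LinearMap.range (S.toFun - (conj z) • S.domain.subtype))ᗮ))

/-- `S` is a densely defined nonnegative symmetric operator, `T₀` and `T₁` are nonnegative
selfadjoint extensions of `S` with `dom T₀ ∩ dom T₁ = dom S`, and the form `T₀[·,·]` is a closed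
restriction of the form `T₁[·,·]`. -/
structure SpecialPair (S : H →ₗ.[ℂ] H) (T₀ T₁ : NonnegSAOp H) : Prop where
  dense : Dense (S.domain : Set H)
  symmetric : S.IsFormalAdjoint S
  nonneg : ∀ u : S.domain, 0 ≤ (⟪S u, (u : H)⟫_ℂ).re
  le₀ : S ≤ T₀.op
  le₁ : S ≤ T₁.op
  disjoint : T₀.op.domain ⊓ T₁.op.domain = S.domain
  form_restriction : T₀.form.IsRestriction T₁.form

/-- The properties: `T₀ ∩ T₁ = S` (intersection of graphs), the form `T₀[·,·]` is a closed
restriction of the form `T₁[·,·]`, and `inf {T₁[u - φ] : φ ∈ D[T₀]} = 0` for all `u ∈ D[T₁]`. -/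
structure ExtremalPair (S : H →ₗ.[ℂ] H) (T₀ T₁ : NonnegSAOp H) : Prop where
  inf_eq : T₀.op ⊓ T₁.op = S
  form_restriction : T₀.form.IsRestriction T₁.form
  approx : ∀ u : T₁.form.dom,
    IsGLB {r : ℝ | ∃ φ : T₁.form.dom, (φ : H) ∈ T₀.form.dom ∧
      r = (T₁.form.val (u - φ) (u - φ)).re} 0

/-- `D[T₁] ⊖ D[T₀]`, the orthogonal complement of `D[T₀]` in the Hilbert space `D[T₁]` with the
inner product `T₁[u, v] + (u, v)`. -/
def formComplement (T₀ T₁ : NonnegSAOp H) : Submodule ℂ H where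
  carrier := {v | ∃ hv : v ∈ T₁.form.dom, ∀ u : T₁.form.dom, (u : H) ∈ T₀.form.dom →
    T₁.form.val u ⟨v, hv⟩ + ⟪(u : H), v⟫_ℂ = 0}
  zero_mem' := ⟨zero_mem _, fun u _ => by
    have : (⟨0, zero_mem _⟩ : T₁.form.dom) = 0 := rfl
    rw [this, map_zero, inner_zero_right, add_zero]⟩
  add_mem' := by
    rintro v w ⟨hv, h1⟩ ⟨hw, h2⟩
    refine ⟨add_mem hv hw, fun u hu => ?_⟩
    have : (⟨v + w, add_mem hv hw⟩ : T₁.form.dom) = ⟨v, hv⟩ + ⟨w, hw⟩ := rfl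
    rw [this, map_add, inner_add_right]
    linear_combination h1 u hu + h2 u hu
  smul_mem' := by
    rintro c v ⟨hv, h1⟩
    refine ⟨Submodule.smul_mem _ c hv, fun u hu => ?_⟩
    have : (⟨c • v, Submodule.smul_mem _ c hv⟩ : T₁.form.dom) = c • ⟨v, hv⟩ := rfl
    rw [this, map_smul, inner_smul_right, smul_eq_mul]
    linear_combination c * h1 u hu

/-- The linear manifold `L = dom T₀ ∔ (D[T₁] ⊖ D[T₀])`. -/
def manifoldL (T₀ T₁ : NonnegSAOp H) : Submodule ℂ H := T₀.op.domain ⊔ formComplement T₀ T₁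

namespace SpecialPair

variable {S : H →ₗ.[ℂ] H} {T₀ T₁ : NonnegSAOp H}

theorem manifoldL_le_dom (hp : SpecialPair S T₀ T₁) : manifoldL T₀ T₁ ≤ T₁.form.dom :=
  sup_le (T₀.domain_le.trans hp.form_restriction.dom_le) (fun _ hv => hv.choose)

theorem manifoldL_le_adjoint (hp : SpecialPair S T₀ T₁) : manifoldL T₀ T₁ ≤ S.adjoint.domain := by
  refine sup_le (fun v hv => ?_) (fun v hv => ?_)
  · refine S.mem_adjoint_domain_of_exists v ⟨T₀.op ⟨v, hv⟩, fun x => ?_⟩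
    have h := T₀.formalAdjoint ⟨v, hv⟩ ⟨x, hp.le₀.1 x.2⟩
    have h2 : S x = T₀.op ⟨x, hp.le₀.1 x.2⟩ := hp.le₀.2 rfl
    rw [h2]
    exact h
  · obtain ⟨hv1, h⟩ := hv
    refine S.mem_adjoint_domain_of_exists v ⟨-v, fun x => ?_⟩
    have hx0 : (x : H) ∈ T₀.form.dom := T₀.domain_le (hp.le₀.1 x.2)
    have h1 := h (Submodule.inclusion T₁.domain_le ⟨x, hp.le₁.1 x.2⟩) hx0
    rw [T₁.form_apply] at h1
    have h2 : S x = T₁.op ⟨x, hp.le₁.1 x.2⟩ := hp.le₁.2 rfl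
    rw [← h2] at h1
    have h3 := congrArg conj h1
    rw [map_add, inner_conj_symm, map_zero] at h3
    change _ + conj ⟪(x : H), v⟫_ℂ = 0 at h3
    rw [inner_conj_symm] at h3
    rw [inner_neg_left]
    linear_combination -h3

end SpecialPair

/-- `(B₁ - B₀)^{1/2}`, where `B₀`, `B₁` are the Cayley transforms of `T₀`, `T₁`. -/
def rootDiff (T₀ T₁ : NonnegSAOp H) : H →L[ℂ] H := CFC.sqrt (T₁.cayley - T₀.cayley)

theorem SpecialPair.rootDiff_mem {S : H →ₗ.[ℂ] H} {T₀ T₁ : NonnegSAOp H}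
    (hp : SpecialPair S T₀ T₁) (f : H) : rootDiff T₀ T₁ f ∈ defectSpace S (-1) := by
  have hsa : ∀ g h : H, ⟪rootDiff T₀ T₁ g, h⟫_ℂ = ⟪g, rootDiff T₀ T₁ h⟫_ℂ := by
    have h : IsSelfAdjoint (rootDiff T₀ T₁) := (CFC.sqrt_nonneg _).isSelfAdjoint
    exact ContinuousLinearMap.isSelfAdjoint_iff_isSymmetric.mp h
  by_cases hpos : 0 ≤ T₁.cayley - T₀.cayley
  · refine (Submodule.mem_orthogonal _ _).mpr ?_
    rintro _ ⟨u, rfl⟩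
    have hu : (S.toFun - (conj (-1 : ℂ)) • S.domain.subtype) u = S u + (u : H) := by
      change S u - conj (-1 : ℂ) • (u : H) = _
      simp
    rw [hu, ← hsa]
    have hz : rootDiff T₀ T₁ (S u + (u : H)) = 0 := by
      have h0 : T₀.resolventOne (S u + (u : H)) = u := by
        have h2 : S u = T₀.op ⟨u, hp.le₀.1 u.2⟩ := hp.le₀.2 rfl
        rw [h2]
        exact T₀.resolventOne_onePlus ⟨u, hp.le₀.1 u.2⟩
      have h1 : T₁.resolventOne (S u + (u : H)) = u := by
        have h2 : S u = T₁.op ⟨u, hp.le₁.1 u.2⟩ := hp.le₁.2 rfl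
        rw [h2]
        exact T₁.resolventOne_onePlus ⟨u, hp.le₁.1 u.2⟩
      have hsq := congrArg (fun A : H →L[ℂ] H => A (S u + (u : H)))
        (CFC.sqrt_mul_sqrt_self (T₁.cayley - T₀.cayley) hpos)
      have hsq' : rootDiff T₀ T₁ (rootDiff T₀ T₁ (S u + (u : H))) = 0 := by
        refine Eq.trans hsq ?_
        simp only [NonnegSAOp.cayley, _root_.sub_apply,
          _root_.add_apply, _root_.smul_apply, h0, h1, sub_self]
      rw [← inner_self_eq_zero (𝕜 := ℂ), hsa, hsq', inner_zero_right]
    rw [hz, inner_zero_left]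
  · have : rootDiff T₀ T₁ = 0 := CFC.sqrt_of_not_nonneg hpos
    rw [this]
    exact zero_mem _

/-- The operator `I + (B₁ - B₀)^{1/2} (B₀ - lam I)⁻¹ (B₁ - B₀)^{1/2}` on the whole space, for
`lam` in the resolvent set of the selfadjoint contraction `B₀`. -/
def qOperator (T₀ T₁ : NonnegSAOp H) (lam : ℂ) : H →L[ℂ] H :=
  1 + rootDiff T₀ T₁ * Ring.inverse (T₀.cayley - lam • (1 : H →L[ℂ] H)) * rootDiff T₀ T₁

/-- The function `Q₀`: the restriction of
`(B₁ - B₀)^{1/2} (B₀ - lam I)⁻¹ (B₁ - B₀)^{1/2} + I` to `N = N_{-1}`, as an operator in `N`. -/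
def qFunction {S : H →ₗ.[ℂ] H} {T₀ T₁ : NonnegSAOp H} (hp : SpecialPair S T₀ T₁) (lam : ℂ) :
    defectSpace S (-1) →L[ℂ] defectSpace S (-1) :=
  (qOperator T₀ T₁ lam ∘L (defectSpace S (-1)).subtypeL).codRestrict (defectSpace S (-1))
    (fun h => (defectSpace S (-1)).add_mem h.2 (hp.rootDiff_mem _))

/-! ### Boundary triplets and Weyl functions -/

/-- The cut plane `ℂ \ [0, ∞)`. -/
def cutPlane : Set ℂ := ((fun x : ℝ => (x : ℂ)) '' Set.Ici 0)ᶜ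

/-- A boundary pair `{K, Γ₀}` for `{T₀, T₁}`: `Γ₀` is a continuous linear operator from the
Hilbert space `D[T₁]` onto `K` with kernel `D[T₀]`. -/
structure BoundaryPair (T₀ T₁ : NonnegSAOp H) (K : Type*) [NormedAddCommGroup K]
    [InnerProductSpace ℂ K] where
  Γ₀ : T₁.form.dom →ₗ[ℂ] K
  bounded : ∃ C : ℝ, ∀ u, ‖Γ₀ u‖ ^ 2 ≤ C * ((T₁.form.val u u).re + ‖(u : H)‖ ^ 2)
  ker_eq : ∀ u, Γ₀ u = 0 ↔ (u : H) ∈ T₀.form.dom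
  surjective : Function.Surjective Γ₀

/-- A boundary triplet `{K, Γ₀, Γ₁}` for `{T₀, T₁}`: a boundary pair with the linear operator
`Γ₁ : L → K` such that `T₁[u, v] = (S* u, v) - (Γ₁ u, Γ₀ v)` for all `u ∈ L`, `v ∈ D[T₁]`. -/
structure BoundaryTriplet {S : H →ₗ.[ℂ] H} {T₀ T₁ : NonnegSAOp H} (hp : SpecialPair S T₀ T₁)
    (K : Type*) [NormedAddCommGroup K] [InnerProductSpace ℂ K] extends BoundaryPair T₀ T₁ K where
  Γ₁ : manifoldL T₀ T₁ →ₗ[ℂ] K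
  green : ∀ (u : manifoldL T₀ T₁) (v : T₁.form.dom),
    T₁.form.val (Submodule.inclusion hp.manifoldL_le_dom u) v =
      ⟪S.adjoint (Submodule.inclusion hp.manifoldL_le_adjoint u), (v : H)⟫_ℂ - ⟪Γ₁ u, Γ₀ v⟫_ℂ

namespace BoundaryTriplet

variable {K : Type*} [NormedAddCommGroup K] [InnerProductSpace ℂ K]
variable {S : H →ₗ.[ℂ] H} {T₀ T₁ : NonnegSAOp H} {hp : SpecialPair S T₀ T₁}
variable (bt : BoundaryTriplet hp K)

/-- The restriction of `Γ₀` to `N_z ∩ L`. -/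
def Γ₀res (z : ℂ) : (defectSpace S z ⊓ manifoldL T₀ T₁ : Submodule ℂ H) →ₗ[ℂ] K :=
  bt.Γ₀ ∘ₗ Submodule.inclusion (inf_le_right.trans hp.manifoldL_le_dom)

/-- The `Γ₀`-field: the inverse of the restriction of `Γ₀` to `N_z ∩ L`
(this restriction is bijective for `z ∈ ℂ \ [0, ∞)`). -/
def gammaField (z : ℂ) : K → (defectSpace S z ⊓ manifoldL T₀ T₁ : Submodule ℂ H) :=
  Function.invFun (bt.Γ₀res z)

/-- The Weyl function `M(z) = Γ₁ Γ₀(z)`. -/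
def weyl (z : ℂ) (h : K) : K :=
  bt.Γ₁ (Submodule.inclusion inf_le_right (bt.gammaField z h))

end BoundaryTriplet

/-- The class `S_F(K)`: Herglotz-Nevanlinna functions with values in `L(K)`, holomorphic on
`ℂ \ [0, ∞)`, such that `M(z)⁻¹ ∈ L(K)` for all `z`, `M(x) → 0` strongly as `x ↑ 0`,
`(M(x) g, g) → -∞` as `x ↓ -∞` for `g ≠ 0`, and `x⁻¹ M(x) → 0` strongly as `x ↓ -∞`. -/
structure ClassSF {K : Type*} [NormedAddCommGroup K] [InnerProductSpace ℂ K] [CompleteSpace K]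
    (M : ℂ → K →L[ℂ] K) : Prop where
  holomorphic : DifferentiableOn ℂ M cutPlane
  symmetric : ∀ z ∈ cutPlane, M (conj z) = ContinuousLinearMap.adjoint (M z)
  im_nonneg : ∀ z : ℂ, 0 < z.im → ∀ g : K, 0 ≤ (⟪g, M z g⟫_ℂ).im
  isUnit : ∀ z ∈ cutPlane, IsUnit (M z)
  tendsto_zero : ∀ g : K, Tendsto (fun x : ℝ => M (x : ℂ) g) (𝓝[<] 0) (𝓝 0)
  tendsto_atBot : ∀ g : K, g ≠ 0 →
    Tendsto (fun x : ℝ => (⟪g, M (x : ℂ) g⟫_ℂ).re) atBot atBot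
  tendsto_inv_smul : ∀ g : K, Tendsto (fun x : ℝ => (x : ℂ)⁻¹ • M (x : ℂ) g) atBot (𝓝 0)

end NonnegTriplet

end

open NonnegTriplet

noncomputable section

/-! Everything takes place in the Hilbert space D[T₁] with inner product T₁[u,v] + (u,v), where
D[T₀] = ker Γ₀ is closed. Its embedding J into H satisfies J J* = (I + T₁)⁻¹. Let γ be the right
inverse of Γ₀ with values orthogonal to D[T₀]. Then Γ₀(-1) = Jγ, and Γ₀(z) = (I + T₀)(T₀ - z)⁻¹Jγ,
since the correction lies in dom T₀, where Γ₀ vanishes. Green's identity with S*u = zu gives M(z) =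
(1 + z)(Jγ)*Γ₀(z) - γ*γ (`weylOp`).

For f in H, the lift a to D[T₁] of (I + T₁)⁻¹f - (I + T₀)⁻¹f is orthogonal to D[T₀], and its squared
norm is the quadratic form of the resolvent difference at f (`exists_lift_diff`). Hence B₁ - B₀ ≥ 0,
and both ‖(B₁ - B₀)^{1/2}f‖ and ‖(Jγ)*f‖ are comparable to ‖a‖. Douglas' lemma in both directions
produces X₀ (`exists_equiv`). The formula for M follows from γ*γ = 2X₀*X₀ (`inner_gamma_gamma`) and
the Möbius change λ = (1 - z)/(1 + z).

If u lifts Γ₀(z)h, then -(M(z)h, h) = T₁[u] - z̄‖u‖² (inner products antilinear on the left). This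
yields the Herglotz property and invertibility. For x < 0 it is the minimum of T₁[v] - x‖v‖² over
Γ₀v = h (`quad_le`), so limits (2) and (4) follow from trial vectors; the divergence (3) uses the
density of ran J* (`denseRange_adjoint_embed`). -/

namespace NonnegTriplet

/-! ### Bounded operators in Hilbert spaces -/

section Bounded

variable {E F H : Type*} [NormedAddCommGroup E] [InnerProductSpace ℂ E] [CompleteSpace E]
  [NormedAddCommGroup F] [InnerProductSpace ℂ F] [CompleteSpace F]
  [NormedAddCommGroup H] [InnerProductSpace ℂ H] [CompleteSpace H]

open ContinuousLinearMap in
/-- Range inclusion (Douglas' lemma) from comparison of the adjoints. -/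
theorem exists_preimage_of_norm_adjoint_le (A : E →L[ℂ] H) (B : F →L[ℂ] H) {c : ℝ} (hc : 0 ≤ c)
    (h : ∀ f, ‖adjoint A f‖ ≤ c * ‖adjoint B f‖) (x : E) :
    ∃ y, B y = A x ∧ ‖y‖ ≤ c * ‖x‖ := by
  -- The functional B*f ↦ ⟪x, A*f⟫ on ran B* is bounded by c‖x‖; Hahn-Banach extends it with the
  -- same norm and the Riesz representation yields y. The map `s` only selects preimages.
  let p : Submodule ℂ F := LinearMap.range (adjoint B : H →ₗ[ℂ] F)
  obtain ⟨s, hs⟩ := (adjoint B : H →ₗ[ℂ] F).rangeRestrict.exists_rightInverse_of_surjective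
    (LinearMap.range_rangeRestrict _)
  have hs' : ∀ q : p, adjoint B (s q) = q := fun q =>
    congrArg Subtype.val (LinearMap.congr_fun hs q)
  let φ : p →L[ℂ] ℂ := LinearMap.mkContinuous
    ((innerSL ℂ x : E →ₗ[ℂ] ℂ) ∘ₗ (adjoint A : H →ₗ[ℂ] E) ∘ₗ s) (c * ‖x‖) (fun q => by
      change ‖⟪x, adjoint A (s q)⟫_ℂ‖ ≤ _
      calc ‖⟪x, adjoint A (s q)⟫_ℂ‖ ≤ ‖x‖ * ‖adjoint A (s q)‖ := norm_inner_le_norm _ _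
        _ ≤ ‖x‖ * (c * ‖adjoint B (s q)‖) := by gcongr; exact h _
        _ = c * ‖x‖ * ‖q‖ := by rw [hs', Submodule.coe_norm]; ring)
  obtain ⟨ψ, hψ, hn⟩ := exists_extension_norm_eq p φ
  refine ⟨(InnerProductSpace.toDual ℂ F).symm ψ, ?_, ?_⟩
  · refine ext_inner_right ℂ fun f => ?_
    rw [← adjoint_inner_right, ← adjoint_inner_right, InnerProductSpace.toDual_symm_apply]
    have h1 : ψ (adjoint B f) = ⟪x, adjoint A (s ⟨adjoint B f, ⟨f, rfl⟩⟩)⟫_ℂ :=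
      hψ ⟨adjoint B f, ⟨f, rfl⟩⟩
    -- Independence of the selected preimage: `s (B* f) - f` lies in ker B*, hence in ker A* by `h`.
    have h2 := h (s ⟨adjoint B f, ⟨f, rfl⟩⟩ - f)
    rw [map_sub (adjoint B), hs', sub_self, norm_zero, mul_zero, map_sub] at h2
    rw [h1, sub_eq_zero.mp (norm_le_zero_iff.mp h2)]
  · rw [LinearIsometryEquiv.norm_map, hn]
    exact LinearMap.mkContinuous_norm_le _ (by positivity) _

/-- Cauchy-Schwarz inequality for the form of a nonnegative operator. -/
theorem norm_sq_apply_le_of_isPositive {A : H →L[ℂ] H} (hA : A.IsPositive) {C : ℝ}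
    (hC : ∀ f, (⟪A f, f⟫_ℂ).re ≤ C * ‖f‖ ^ 2) (f : H) :
    ‖A f‖ ^ 2 ≤ C * (⟪A f, f⟫_ℂ).re := by
  have h0 : 0 ≤ A := ContinuousLinearMap.nonneg_iff_isPositive A |>.mpr hA
  set R : H →L[ℂ] H := CFC.sqrt A with hR
  have hRR : ∀ f, R (R f) = A f := fun f =>
    congrArg (fun A : H →L[ℂ] H => A f) (CFC.sqrt_mul_sqrt_self A h0)
  have hsa : ∀ f g, ⟪R f, g⟫_ℂ = ⟪f, R g⟫_ℂ :=
    ContinuousLinearMap.isSelfAdjoint_iff_isSymmetric.mp (CFC.sqrt_nonneg A).isSelfAdjoint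
  have hq : ∀ f, (⟪A f, f⟫_ℂ).re = ‖R f‖ ^ 2 := fun f => by
    rw [← hRR, hsa]
    exact inner_self_eq_norm_sq (𝕜 := ℂ) _
  -- With R² = A, the bound at Rf reads ‖Af‖² ≤ C‖Rf‖², and ‖Rf‖² = (Af, f).
  have h1 := hC (R f)
  rw [hq, hRR] at h1
  rwa [hq]

/-- Off `[0, ∞)`, the numbers `s - z r` with `s, r ≥ 0` are bounded below. -/
theorem exists_le_norm_sub_mul {z : ℂ} (hz : z ∈ cutPlane) :
    ∃ c : ℝ, 0 < c ∧ ∀ s r : ℝ, 0 ≤ s → 0 ≤ r → c * (s + r) ≤ ‖(s : ℂ) - z * r‖ := by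
  by_cases him : z.im = 0
  · have hre : z.re < 0 := by
      by_contra! h
      exact hz ⟨z.re, h, Complex.ext rfl him.symm⟩
    refine ⟨min 1 (-z.re), lt_min one_pos (by linarith), fun s r hs hr => ?_⟩
    refine le_trans ?_ (Complex.re_le_norm _)
    have h1 := min_le_left 1 (-z.re)
    have h2 := min_le_right 1 (-z.re)
    simp only [Complex.sub_re, Complex.ofReal_re, Complex.mul_re, him, Complex.ofReal_im]
    nlinarith
  · have hi : 0 < |z.im| := abs_pos.mpr him
    have hD : 0 < |z.im| + ‖z‖ + 1 := by positivity
    -- The constant comes from adding |Im z| times `h2` to (‖z‖ + 1) times `h1`: the terms in ‖z‖r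
    -- cancel and |Im z|(s + r) remains.
    refine ⟨|z.im| / (|z.im| + ‖z‖ + 1), by positivity, fun s r hs hr => ?_⟩
    have h1 : |z.im| * r ≤ ‖(s : ℂ) - z * r‖ := by
      have := Complex.abs_im_le_norm ((s : ℂ) - z * r)
      simpa [abs_mul, abs_of_nonneg hr] using this
    have h2 : s - ‖z‖ * r ≤ ‖(s : ℂ) - z * r‖ := by
      have := norm_sub_norm_le (s : ℂ) (z * r)
      simpa [abs_of_nonneg hr, abs_of_nonneg hs] using this
    rw [div_mul_eq_mul_div, div_le_iff₀ hD]
    nlinarith [mul_le_mul_of_nonneg_left h2 hi.le,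
      mul_le_mul_of_nonneg_left h1 (by positivity : 0 ≤ ‖z‖ + 1)]

/-- An operator with a coercive sesquilinear form is invertible. -/
theorem isUnit_of_coercive (A : H →L[ℂ] H) {c : ℝ} (hc : 0 < c)
    (h : ∀ f, c * ‖f‖ ^ 2 ≤ ‖⟪A f, f⟫_ℂ‖) : IsUnit A :=
  A.isUnit_of_forall_le_norm_inner_map (c := ⟨c, hc.le⟩) hc fun f => by
    rw [mul_comm]; exact h f

theorem cutPlane_conj {z : ℂ} (hz : z ∈ cutPlane) : conj z ∈ cutPlane := by
  rintro ⟨x, hx, h⟩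
  refine hz ⟨x, hx, ?_⟩
  rw [← Complex.conj_conj z, ← h]
  exact (Complex.conj_ofReal x).symm

theorem ofReal_mem_cutPlane {x : ℝ} (hx : x < 0) : (x : ℂ) ∈ cutPlane := by
  rintro ⟨y, hy, h⟩
  exact absurd (Complex.ofReal_injective h) (ne_of_gt (lt_of_lt_of_le hx hy))

theorem neg_one_mem_cutPlane : (-1 : ℂ) ∈ cutPlane := by
  have := ofReal_mem_cutPlane (x := -1) (by norm_num)
  simpa using this

end Bounded

/-! ### The inverse of `I - (1 + z) (I + T)⁻¹` -/

namespace NonnegSAOp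

variable {H : Type*} [NormedAddCommGroup H] [InnerProductSpace ℂ H] [CompleteSpace H]
  (T : NonnegSAOp H)

theorem resolventOne_isPositive : T.resolventOne.IsPositive :=
  (ContinuousLinearMap.nonneg_iff_isPositive _).mp T.resolventOne_nonneg

/-- With r = ((I + T)⁻¹f, f) in [0, ‖f‖²], the form of this operator is s - z̄r, where s = ‖f‖² - r
≥ 0 and s + r = ‖f‖². It is therefore coercive off [0, ∞). -/
theorem isUnit_one_sub {z : ℂ} (hz : z ∈ cutPlane) :
    IsUnit (1 - (1 + z) • T.resolventOne) := by
  obtain ⟨c, hc, h⟩ := exists_le_norm_sub_mul (cutPlane_conj hz)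
  refine isUnit_of_coercive _ hc fun f => ?_
  have hr := T.resolventOne_isPositive.inner_nonneg_left f
  obtain ⟨hr0, him⟩ := Complex.nonneg_iff.mp hr
  set r := (⟪T.resolventOne f, f⟫_ℂ).re with hrd
  have hre : ⟪T.resolventOne f, f⟫_ℂ = (r : ℂ) := Complex.ext rfl him.symm
  have hr1 : r ≤ ‖f‖ ^ 2 := by
    calc r ≤ ‖⟪T.resolventOne f, f⟫_ℂ‖ := Complex.re_le_norm _
      _ ≤ ‖T.resolventOne f‖ * ‖f‖ := norm_inner_le_norm _ _
      _ ≤ ‖f‖ * ‖f‖ := by gcongr; exact T.norm_resolventOne_apply_le f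
      _ = ‖f‖ ^ 2 := (sq _).symm
  have hv : ⟪(1 - (1 + z) • T.resolventOne) f, f⟫_ℂ = ((‖f‖ ^ 2 - r : ℝ) : ℂ) - conj z * r := by
    change ⟪f - (1 + z) • T.resolventOne f, f⟫_ℂ = _
    rw [inner_sub_left, inner_smul_left, hre, inner_self_eq_norm_sq_to_K]
    simp
    ring
  have := h (‖f‖ ^ 2 - r) r (by linarith) hr0
  rw [hv]
  linarith

/-- `(I - (1 + z) (I + T)⁻¹)⁻¹ = (I + T) (T - z)⁻¹`. -/
def transfer (z : ℂ) : H →L[ℂ] H := Ring.inverse (1 - (1 + z) • T.resolventOne)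

variable {T} {z : ℂ}

theorem transfer_eq (hz : z ∈ cutPlane) (f : H) :
    T.transfer z f = f + (1 + z) • T.resolventOne (T.transfer z f) := by
  have := congrArg (fun A : H →L[ℂ] H => A f) (Ring.mul_inverse_cancel _ (T.isUnit_one_sub hz))
  have h : T.transfer z f - (1 + z) • T.resolventOne (T.transfer z f) = f := this
  rw [sub_eq_iff_eq_add] at h
  exact h

theorem eq_zero_of_resolventOne (hz : z ∈ cutPlane) {f : H}
    (hf : f = (1 + z) • T.resolventOne f) : f = 0 := by
  have := congrArg (fun A : H →L[ℂ] H => A f) (Ring.inverse_mul_cancel _ (T.isUnit_one_sub hz))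
  have h : T.transfer z (f - (1 + z) • T.resolventOne f) = f := this
  rw [← h, sub_eq_zero.mpr hf, map_zero]

theorem adjoint_transfer (z : ℂ) :
    ContinuousLinearMap.adjoint (T.transfer z) = T.transfer (conj z) := by
  have h : star (1 - (1 + z) • T.resolventOne) = 1 - (1 + conj z) • T.resolventOne := by
    have hs : star T.resolventOne = T.resolventOne := T.resolventOne_isPositive.isSelfAdjoint
    rw [star_sub, star_one, star_smul, hs]
    simp
  change star (Ring.inverse _) = _
  rw [← Ring.inverse_star, h]
  rfl

theorem differentiableOn_transfer : DifferentiableOn ℂ T.transfer cutPlane := by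
  intro z hz
  have h : DifferentiableAt ℂ (fun z : ℂ => 1 - (1 + z) • T.resolventOne) z := by fun_prop
  exact ((differentiableAt_inverse (𝕜 := ℂ) (T.isUnit_one_sub hz)).comp z h).differentiableWithinAt

/-- With λ = (1 - z)/(1 + z) one has 1 + λ = 2/(1 + z), so the resolvent of the Cayley transform at
λ is a multiple of `transfer z`. -/
theorem cayley_sub_smul (hz1 : z ≠ -1) : T.cayley - ((1 - z) / (1 + z)) • (1 : H →L[ℂ] H) =
    (-2 / (1 + z)) • (1 - (1 + z) • T.resolventOne) := by
  have h1 : (1 + z) ≠ 0 := fun h => hz1 (by linear_combination h)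
  ext f
  simp only [cayley, sub_apply, add_apply, smul_apply, neg_apply, one_apply_eq_self, smul_sub,
    smul_smul]
  match_scalars
  · field_simp
    ring
  · field_simp

theorem isUnit_cayley_sub_smul (hz : z ∈ cutPlane) (hz1 : z ≠ -1) :
    IsUnit (T.cayley - ((1 - z) / (1 + z)) • (1 : H →L[ℂ] H)) := by
  have h1 : (1 + z) ≠ 0 := fun h => hz1 (by linear_combination h)
  rw [cayley_sub_smul hz1]
  exact (T.isUnit_one_sub hz).smul (Units.mk0 _ (div_ne_zero (by norm_num) h1))

theorem inverse_cayley_sub_smul (hz : z ∈ cutPlane) (hz1 : z ≠ -1) :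
    Ring.inverse (T.cayley - ((1 - z) / (1 + z)) • (1 : H →L[ℂ] H)) =
      (-(1 + z) / 2) • T.transfer z := by
  have h1 : (1 + z) ≠ 0 := fun h => hz1 (by linear_combination h)
  have h : (-(1 + z) / 2) • T.transfer z *
      (T.cayley - ((1 - z) / (1 + z)) • (1 : H →L[ℂ] H)) = 1 := by
    rw [cayley_sub_smul hz1, smul_mul_smul_comm, transfer,
      Ring.inverse_mul_cancel _ (T.isUnit_one_sub hz),
      show -(1 + z) / 2 * (-2 / (1 + z)) = 1 by field_simp, one_smul]
  have h2 := Ring.mul_inverse_cancel _ (isUnit_cayley_sub_smul (T := T) hz hz1)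
  exact (left_inv_eq_right_inv h h2).symm

end NonnegSAOp

/-! ### The Hilbert space of a closed form -/

section FormSpace

variable {H : Type*} [NormedAddCommGroup H] [InnerProductSpace ℂ H]

/-- Polarization: a form that is real on the diagonal is Hermitian, as the vectors u + v and u + iv
show. -/
theorem ClosedForm.conj_val (t : ClosedForm H) (u v : t.dom) : conj (t.val u v) = t.val v u := by
  have h1 := t.im_eq_zero (u + v)
  have h2 := t.im_eq_zero (u + Complex.I • v)
  have hu := t.im_eq_zero u
  have hv := t.im_eq_zero v
  simp only [map_add, LinearMap.add_apply, Complex.add_im, Complex.add_re, LinearMap.map_smulₛₗ,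
    LinearMap.smul_apply, smul_eq_mul, Complex.mul_im, Complex.mul_re, Complex.conj_I,
    Complex.neg_re, Complex.neg_im, Complex.I_re, Complex.I_im, RingHom.id_apply] at h1 h2
  apply Complex.ext
  · rw [Complex.conj_re]; linarith
  · rw [Complex.conj_im]; linarith

/-- The domain of a closed form `t` as a Hilbert space with inner product `t[u, v] + (u, v)`. -/
def FormSpace (t : ClosedForm H) : Type _ := t.dom

variable {t : ClosedForm H}

instance : AddCommGroup (FormSpace t) := inferInstanceAs (AddCommGroup t.dom)

instance : Module ℂ (FormSpace t) := inferInstanceAs (Module ℂ t.dom)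

/-- The identity map from the form domain to the Hilbert space of the form. -/
def FormSpace.of (t : ClosedForm H) : t.dom ≃ₗ[ℂ] FormSpace t := LinearEquiv.refl ℂ t.dom

/-- The inner product `t[u, v] + (u, v)`. -/
@[reducible] def FormSpace.core (t : ClosedForm H) : InnerProductSpace.Core ℂ (FormSpace t) where
  inner u v := t.val ((FormSpace.of t).symm u) ((FormSpace.of t).symm v) +
    ⟪((FormSpace.of t).symm u : H), ((FormSpace.of t).symm v : H)⟫_ℂ
  conj_inner_symm u v := by rw [map_add, t.conj_val, inner_conj_symm]
  re_inner_nonneg u := by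
    change 0 ≤ (_ + _ : ℂ).re
    rw [Complex.add_re]
    exact add_nonneg (t.nonneg _) (inner_self_nonneg (𝕜 := ℂ))
  add_left u v w := by
    simp only [map_add, LinearMap.add_apply, Submodule.coe_add, inner_add_left]
    ring
  smul_left u v c := by
    simp only [map_smul, LinearMap.map_smulₛₗ, LinearMap.smul_apply, Submodule.coe_smul,
      inner_smul_left, smul_eq_mul]
    ring
  definite u hu := by
    have h := congrArg Complex.re hu
    rw [Complex.add_re, Complex.zero_re] at h
    have h1 := t.nonneg ((FormSpace.of t).symm u)
    have h2 : (⟪((FormSpace.of t).symm u : H), ((FormSpace.of t).symm u : H)⟫_ℂ).re =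
      ‖((FormSpace.of t).symm u : H)‖ ^ 2 := inner_self_eq_norm_sq (𝕜 := ℂ) _
    rw [h2] at h
    have h3 : ‖((FormSpace.of t).symm u : H)‖ ^ 2 = 0 :=
      le_antisymm (by linarith) (by positivity)
    have h4 : (FormSpace.of t).symm u = 0 :=
      Subtype.ext (norm_eq_zero.mp (pow_eq_zero_iff two_ne_zero |>.mp h3))
    exact (FormSpace.of t).symm.map_eq_zero_iff.mp h4

instance : NormedAddCommGroup (FormSpace t) := (FormSpace.core t).toNormedAddCommGroup

instance : InnerProductSpace ℂ (FormSpace t) := InnerProductSpace.ofCore (FormSpace.core t).toCore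

namespace FormSpace

theorem inner_of (u v : t.dom) :
    ⟪of t u, of t v⟫_ℂ = t.val u v + ⟪(u : H), (v : H)⟫_ℂ := rfl

theorem norm_sq_of (u : t.dom) : ‖of t u‖ ^ 2 = (t.val u u).re + ‖(u : H)‖ ^ 2 := by
  have h1 : (⟪of t u, of t u⟫_ℂ).re = ‖of t u‖ ^ 2 :=
    inner_self_eq_norm_sq (𝕜 := ℂ) (of t u)
  have h2 : (⟪(u : H), (u : H)⟫_ℂ).re = ‖(u : H)‖ ^ 2 := inner_self_eq_norm_sq (𝕜 := ℂ) _
  rw [← h1, inner_of, Complex.add_re, h2]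

/-- The embedding of the Hilbert space of the form into `H`. -/
def embed (t : ClosedForm H) : FormSpace t →L[ℂ] H :=
  (t.dom.subtype ∘ₗ (of t).symm.toLinearMap).mkContinuous 1 (fun u => by
    obtain ⟨u, rfl⟩ := (of t).surjective u
    change ‖(u : H)‖ ≤ 1 * _
    rw [one_mul]
    refine le_of_sq_le_sq ?_ (norm_nonneg _)
    rw [norm_sq_of]
    linarith [t.nonneg u])

theorem embed_of (u : t.dom) : embed t (of t u) = u := rfl

theorem embed_injective : Function.Injective (embed t) :=
  fun _ _ h => Subtype.ext h

theorem embed_mem (u : FormSpace t) : embed t u ∈ t.dom := Subtype.prop ((of t).symm u)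

theorem norm_embed_le (u : FormSpace t) : ‖embed t u‖ ≤ ‖u‖ :=
  ((embed t).le_of_opNorm_le (LinearMap.mkContinuous_norm_le _ zero_le_one _) u).trans_eq
    (one_mul _)

/-- Convergence in `t.dom` from convergence in `H` and the Cauchy property for the form norm. -/
theorem tendsto_of_cauchySeq {x : ℕ → FormSpace t} (hx : CauchySeq x) {u : H}
    (hu : Tendsto (fun n => embed t (x n)) atTop (𝓝 u)) :
    ∃ w : FormSpace t, embed t w = u ∧ Tendsto x atTop (𝓝 w) := by
  have hq : ∀ v : t.dom, t.val v v = ((‖of t v‖ ^ 2 - ‖(v : H)‖ ^ 2 : ℝ) : ℂ) := by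
    intro v
    refine Complex.ext ?_ ((t.im_eq_zero v).trans (Complex.ofReal_im _).symm)
    rw [Complex.ofReal_re, norm_sq_of]
    ring
  have hc : Tendsto (fun p : ℕ × ℕ => ‖x p.1 - x p.2‖) atTop (𝓝 0) := by
    have := cauchySeq_iff_tendsto_dist_atTop_0.mp hx
    simpa only [dist_eq_norm] using this
  have hv : Tendsto (fun p : ℕ × ℕ => t.val ((of t).symm (x p.1) - (of t).symm (x p.2))
      ((of t).symm (x p.1) - (of t).symm (x p.2))) atTop (𝓝 0) := by
    refine squeeze_zero_norm (a := fun p : ℕ × ℕ => ‖x p.1 - x p.2‖ ^ 2) (fun p => ?_) ?_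
    · rw [hq, Complex.norm_real, Real.norm_eq_abs, abs_of_nonneg]
      · rw [map_sub, LinearEquiv.apply_symm_apply, LinearEquiv.apply_symm_apply]
        linarith [sq_nonneg ‖(((of t).symm (x p.1) - (of t).symm (x p.2) : t.dom) : H)‖]
      · rw [norm_sq_of]
        linarith [t.nonneg ((of t).symm (x p.1) - (of t).symm (x p.2))]
    · simpa using hc.pow 2
  obtain ⟨hmem, hlim⟩ := t.closed (fun n => (of t).symm (x n)) u hu hv
  refine ⟨of t ⟨u, hmem⟩, rfl, ?_⟩
  rw [tendsto_iff_norm_sub_tendsto_zero]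
  have h1 : Tendsto (fun n => ‖x n - of t ⟨u, hmem⟩‖ ^ 2) atTop (𝓝 0) := by
    have h2 := (Complex.continuous_re.tendsto 0).comp hlim
    have h3 := (hu.sub_const u).norm.pow 2
    have h4 := h2.add h3
    rw [sub_self, norm_zero, Complex.zero_re] at h4
    simp only [ne_eq, OfNat.ofNat_ne_zero, not_false_eq_true, zero_pow, add_zero] at h4
    refine h4.congr fun n => ?_
    have h5 := norm_sq_of ((of t).symm (x n) - ⟨u, hmem⟩)
    rw [map_sub, LinearEquiv.apply_symm_apply] at h5
    rw [h5]
    rfl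
  have := (Real.continuous_sqrt.tendsto 0).comp h1
  simpa [Function.comp_def, Real.sqrt_sq] using this

instance [CompleteSpace H] : CompleteSpace (FormSpace t) := by
  refine Metric.complete_of_cauchySeq_tendsto fun x hx => ?_
  obtain ⟨u, hu⟩ := cauchySeq_tendsto_of_complete
    ((embed t).uniformContinuous.comp_cauchySeq hx)
  obtain ⟨w, -, hw⟩ := tendsto_of_cauchySeq hx hu
  exact ⟨w, hw⟩

end FormSpace

end FormSpace

open FormSpace

open ContinuousLinearMap in
/-- A bounded surjection has a bounded right inverse with values orthogonal to the kernel. -/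
theorem exists_orthogonal_section {E K : Type*} [NormedAddCommGroup E] [InnerProductSpace ℂ E]
    [CompleteSpace E] [NormedAddCommGroup K] [InnerProductSpace ℂ K] [CompleteSpace K]
    (Γ : E →L[ℂ] K) (hΓ : Function.Surjective Γ) :
    ∃ γ : K →L[ℂ] E, (∀ h, Γ (γ h) = h) ∧ ∀ h v, Γ v = 0 → ⟪γ h, v⟫_ℂ = 0 := by
  have hcl : IsClosed ((LinearMap.ker (Γ : E →ₗ[ℂ] K) : Submodule ℂ E) : Set E) :=
    Γ.isClosed_ker
  have : CompleteSpace (LinearMap.ker (Γ : E →ₗ[ℂ] K)) := hcl.completeSpace_coe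
  let D : Submodule ℂ E := LinearMap.ker (Γ : E →ₗ[ℂ] K)
  let A : Dᗮ →L[ℂ] K := Γ ∘L Dᗮ.subtypeL
  have hinj : Function.Injective A := by
    refine (injective_iff_map_eq_zero A).mpr fun u hu => ?_
    have h1 : (u : E) ∈ D := hu
    have h2 := (Submodule.mem_orthogonal _ _).mp u.2 u h1
    exact Subtype.ext (inner_self_eq_zero.mp h2)
  have hsurj : Function.Surjective A := fun h => by
    obtain ⟨u, rfl⟩ := hΓ h
    obtain ⟨y, hy, w, hw, huyw⟩ := D.exists_add_mem_mem_orthogonal u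
    refine ⟨⟨w, hw⟩, ?_⟩
    have hy0 : Γ y = 0 := hy
    change Γ w = Γ u
    rw [huyw, map_add, hy0, zero_add]
  -- The open mapping theorem makes the inverse of Γ on (ker Γ)ᗮ bounded.
  let e : Dᗮ ≃L[ℂ] K := ContinuousLinearEquiv.ofBijective A (LinearMap.ker_eq_bot.mpr hinj)
    (LinearMap.range_eq_top.mpr hsurj)
  refine ⟨Dᗮ.subtypeL ∘L (e.symm : K →L[ℂ] Dᗮ), fun h => e.apply_symm_apply h, fun h v hv => ?_⟩
  exact (Submodule.mem_orthogonal' _ _).mp (e.symm h).2 v hv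

/-! ### The adjoint of the embedding of D[T] into H -/

namespace NonnegSAOp

variable {H : Type*} [NormedAddCommGroup H] [InnerProductSpace ℂ H] [CompleteSpace H]
  (T : NonnegSAOp H)

theorem resolventOne_mem (f : H) : T.resolventOne f ∈ T.op.domain :=
  (T.onePlusEquiv.symm f).2

theorem op_resolventOne (f : H) :
    T.op ⟨T.resolventOne f, T.resolventOne_mem f⟩ + T.resolventOne f = f := T.op_symm f

/-- Since (I + T)(I + T)⁻¹f = f, the association of form and operator becomes a Riesz representation
in D[T]; it identifies the adjoint of `embed`. -/
theorem inner_of_resolventOne (f : H) (v : FormSpace T.form) :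
    ⟪of T.form ⟨T.resolventOne f, T.domain_le (T.resolventOne_mem f)⟩, v⟫_ℂ =
      ⟪f, embed T.form v⟫_ℂ := by
  obtain ⟨v, rfl⟩ := (of T.form).surjective v
  have h := T.form_apply ⟨T.resolventOne f, T.resolventOne_mem f⟩ v
  have h2 := T.op_resolventOne f
  rw [inner_of, embed_of]
  conv_rhs => rw [← h2, inner_add_left, ← h]
  rfl

theorem adjoint_embed_apply (f : H) : ContinuousLinearMap.adjoint (embed T.form) f =
    of T.form ⟨T.resolventOne f, T.domain_le (T.resolventOne_mem f)⟩ := by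
  refine ext_inner_right ℂ fun v => ?_
  rw [ContinuousLinearMap.adjoint_inner_left, inner_of_resolventOne]

theorem embed_adjoint_embed (f : H) :
    embed T.form (ContinuousLinearMap.adjoint (embed T.form) f) = T.resolventOne f := by
  rw [adjoint_embed_apply]; rfl

end NonnegSAOp

/-! ### Defect subspaces and the adjoint of S -/

section Defect

variable {H : Type*} [NormedAddCommGroup H] [InnerProductSpace ℂ H] [CompleteSpace H]
  {S : H →ₗ.[ℂ] H} {T₀ T₁ : NonnegSAOp H}

omit [CompleteSpace H] in
theorem mem_defectSpace_iff {z : ℂ} {u : H} :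
    u ∈ defectSpace S z ↔ ∀ x : S.domain, ⟪S x, u⟫_ℂ = z * ⟪(x : H), u⟫_ℂ := by
  rw [defectSpace, Submodule.mem_orthogonal]
  have key : ∀ x : S.domain, ⟪(S.toFun - (conj z) • S.domain.subtype) x, u⟫_ℂ =
      ⟪S x, u⟫_ℂ - z * ⟪(x : H), u⟫_ℂ := fun x => by
    change ⟪S x - (conj z) • (x : H), u⟫_ℂ = _
    rw [inner_sub_left, inner_smul_left, Complex.conj_conj]
  constructor
  · intro h x
    have := h _ ⟨x, rfl⟩
    rw [key] at this
    exact sub_eq_zero.mp this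
  · rintro h _ ⟨x, rfl⟩
    rw [key, h, sub_self]

namespace SpecialPair

variable (hp : SpecialPair S T₀ T₁)
include hp

theorem inner_op_left₀ (x : S.domain) (u : T₀.op.domain) :
    ⟪S x, (u : H)⟫_ℂ = ⟪(x : H), T₀.op u⟫_ℂ := by
  have h2 : S x = T₀.op ⟨x, hp.le₀.1 x.2⟩ := hp.le₀.2 rfl
  rw [h2]
  exact T₀.formalAdjoint _ u

/-- Orthogonality to D[T₀] is tested only on dom S, where T₁[x, v] = (Sx, v). -/
theorem formComplement_le_defectSpace : formComplement T₀ T₁ ≤ defectSpace S (-1) := by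
  rintro v ⟨hv1, h⟩
  refine mem_defectSpace_iff.mpr fun x => ?_
  have hx0 : (x : H) ∈ T₀.form.dom := T₀.domain_le (hp.le₀.1 x.2)
  have h1 := h (Submodule.inclusion T₁.domain_le ⟨x, hp.le₁.1 x.2⟩) hx0
  rw [T₁.form_apply] at h1
  have h2 : S x = T₁.op ⟨x, hp.le₁.1 x.2⟩ := hp.le₁.2 rfl
  rw [← h2] at h1
  change _ + ⟪(x : H), v⟫_ℂ = 0 at h1
  linear_combination h1

theorem op_eq_smul_of_mem_defectSpace {z : ℂ} (u : T₀.op.domain)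
    (hu : (u : H) ∈ defectSpace S z) : T₀.op u = z • (u : H) := by
  have h : ∀ x ∈ S.domain, ⟪x, T₀.op u - z • (u : H)⟫_ℂ = 0 := fun x hx => by
    rw [inner_sub_right, inner_smul_right, ← hp.inner_op_left₀ ⟨x, hx⟩,
      mem_defectSpace_iff.mp hu, sub_self]
  exact sub_eq_zero.mp (hp.dense.eq_zero_of_inner_right ℂ fun x hx => h x hx)

/-- By density of dom S, such a vector satisfies T₀u = zu, which is impossible for u ≠ 0 and z off
[0, ∞). -/
theorem eq_zero_of_mem_defectSpace {z : ℂ} (hz : z ∈ cutPlane) {u : H} (hu0 : u ∈ T₀.op.domain)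
    (hu : u ∈ defectSpace S z) : u = 0 := by
  have h := hp.op_eq_smul_of_mem_defectSpace ⟨u, hu0⟩ hu
  have h2 := T₀.resolventOne_onePlus ⟨u, hu0⟩
  refine NonnegSAOp.eq_zero_of_resolventOne (T := T₀) hz ?_
  rw [h] at h2
  rw [← map_smul, add_smul, one_smul, add_comm]
  exact h2.symm

theorem adjoint_eq_smul_of_mem_defectSpace {z : ℂ} (u : S.adjoint.domain)
    (hu : (u : H) ∈ defectSpace S z) : S.adjoint u = z • (u : H) := by
  refine LinearPMap.adjoint_apply_eq hp.dense u fun x => ?_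
  have h := congrArg conj (mem_defectSpace_iff.mp hu x)
  rw [inner_conj_symm, map_mul, inner_conj_symm] at h
  rw [inner_smul_left, h]

end SpecialPair

end Defect

/-! ### The Γ₀-field and the Weyl function as bounded operators -/

namespace BoundaryTriplet

variable {H : Type*} [NormedAddCommGroup H] [InnerProductSpace ℂ H] [CompleteSpace H]
  {K : Type*} [NormedAddCommGroup K] [InnerProductSpace ℂ K]
  {S : H →ₗ.[ℂ] H} {T₀ T₁ : NonnegSAOp H} {hp : SpecialPair S T₀ T₁}
  (bt : BoundaryTriplet hp K)

/-- `Γ₀` as a bounded operator on the Hilbert space `D[T₁]`. -/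
def trace : FormSpace T₁.form →L[ℂ] K :=
  (bt.Γ₀ ∘ₗ (of T₁.form).symm.toLinearMap).mkContinuousOfExistsBound (by
    obtain ⟨C, hC⟩ := bt.bounded
    -- The constant in `bounded` has no prescribed sign, hence the absolute value.
    refine ⟨√|C|, fun u => ?_⟩
    obtain ⟨u, rfl⟩ := (of T₁.form).surjective u
    refine le_of_sq_le_sq ?_ (by positivity)
    rw [mul_pow, Real.sq_sqrt (abs_nonneg C), norm_sq_of]
    refine (hC u).trans ?_
    have := T₁.form.nonneg u
    gcongr
    exact le_abs_self C)

theorem trace_surjective : Function.Surjective bt.trace := fun h => by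
  obtain ⟨u, rfl⟩ := bt.surjective h
  exact ⟨of T₁.form u, rfl⟩

theorem trace_eq_zero_iff {u : FormSpace T₁.form} :
    bt.trace u = 0 ↔ embed T₁.form u ∈ T₀.form.dom := bt.ker_eq ((of T₁.form).symm u)

theorem Γ₀res_eq {z : ℂ} {u : (defectSpace S z ⊓ manifoldL T₀ T₁ : Submodule ℂ H)}
    {w : FormSpace T₁.form} (hw : embed T₁.form w = u) : bt.Γ₀res z u = bt.trace w := by
  have : w = of T₁.form (Submodule.inclusion (inf_le_right.trans hp.manifoldL_le_dom) u) :=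
    embed_injective hw
  rw [this]
  rfl

/-- The lift of `(I + T₀)⁻¹ f` to `D[T₁]`. -/
theorem exists_lift (f : H) : ∃ w : FormSpace T₁.form, embed T₁.form w = T₀.resolventOne f ∧
    bt.trace w = 0 ∧ ∀ v, bt.trace v = 0 → ⟪w, v⟫_ℂ = ⟪f, embed T₁.form v⟫_ℂ := by
  have h0 := T₀.domain_le (T₀.resolventOne_mem f)
  refine ⟨of T₁.form ⟨T₀.resolventOne f, hp.form_restriction.dom_le h0⟩, rfl,
    bt.trace_eq_zero_iff.mpr h0, fun v hv => ?_⟩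
  have hv0 := bt.trace_eq_zero_iff.mp hv
  have h1 := T₀.inner_of_resolventOne f (of T₀.form ⟨embed T₁.form v, hv0⟩)
  rw [inner_of, ← hp.form_restriction.val_eq] at h1
  exact h1

variable [CompleteSpace K]

/-- `Γ₀(-1)` as a bounded operator into the Hilbert space `D[T₁]`. -/
def gamma : K →L[ℂ] FormSpace T₁.form :=
  (exists_orthogonal_section bt.trace bt.trace_surjective).choose

theorem trace_gamma (h : K) : bt.trace (bt.gamma h) = h :=
  (exists_orthogonal_section bt.trace bt.trace_surjective).choose_spec.1 h

theorem inner_gamma_left (h : K) {v : FormSpace T₁.form} (hv : bt.trace v = 0) :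
    ⟪bt.gamma h, v⟫_ℂ = 0 :=
  (exists_orthogonal_section bt.trace bt.trace_surjective).choose_spec.2 h v hv

theorem inner_gamma_right (h : K) {v : FormSpace T₁.form} (hv : bt.trace v = 0) :
    ⟪v, bt.gamma h⟫_ℂ = 0 :=
  inner_eq_zero_symm.mp (bt.inner_gamma_left h hv)

/-- `Γ₀(-1)` as a bounded operator into `H`. -/
def gammaH : K →L[ℂ] H := embed T₁.form ∘L bt.gamma

theorem gammaH_apply (h : K) : bt.gammaH h = embed T₁.form (bt.gamma h) := rfl

theorem gammaH_mem_formComplement (h : K) : bt.gammaH h ∈ formComplement T₀ T₁ :=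
  ⟨embed_mem _, fun u hu => bt.inner_gamma_right h (v := of T₁.form u)
    (bt.trace_eq_zero_iff.mpr hu)⟩

/-- The operator `Γ₀(z)` into `H`. -/
def gammaZ (z : ℂ) : K →L[ℂ] H := T₀.transfer z ∘L bt.gammaH

/-- Passing from -1 to z changes the Γ₀-field by a vector of dom T₀. This keeps it in L, leaves its
Γ₀-value unchanged and makes it a defect vector for z. -/
theorem gammaZ_eq {z : ℂ} (hz : z ∈ cutPlane) (h : K) :
    bt.gammaZ z h = bt.gammaH h + T₀.resolventOne ((1 + z) • bt.gammaZ z h) := by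
  rw [map_smul]
  exact NonnegSAOp.transfer_eq hz _

theorem gammaZ_mem {z : ℂ} (hz : z ∈ cutPlane) (h : K) :
    bt.gammaZ z h ∈ defectSpace S z ⊓ manifoldL T₀ T₁ := by
  have hc := bt.gammaH_mem_formComplement h
  have he := bt.gammaZ_eq hz h
  have hd := T₀.op_resolventOne ((1 + z) • bt.gammaZ z h)
  refine ⟨mem_defectSpace_iff.mpr fun x => ?_, ?_⟩
  · have h1 := mem_defectSpace_iff.mp (hp.formComplement_le_defectSpace hc) x
    have h2 := hp.inner_op_left₀ x ⟨_, T₀.resolventOne_mem ((1 + z) • bt.gammaZ z h)⟩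
    have h3 := congrArg (fun y => ⟪(x : H), y⟫_ℂ) hd
    have h4 := congrArg (fun y => ⟪(x : H), y⟫_ℂ) he
    have h5 := congrArg (fun y => ⟪S x, y⟫_ℂ) he
    simp only [inner_add_right, inner_smul_right] at h1 h2 h3 h4 h5
    -- For the second summand w of `gammaZ_eq`, (Sx, w) = (x, T₀w) with T₀w = (1 + z)Γ₀(z)h - w.
    -- Adding (Sx, Γ₀(-1)h) = -(x, Γ₀(-1)h) leaves z(x, Γ₀(z)h).
    linear_combination h5 + h1 + h2 + h3 + h4
  · rw [he]
    exact add_mem (Submodule.mem_sup_right hc) (Submodule.mem_sup_left (T₀.resolventOne_mem _))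

/-- The lift of `Γ₀(z) h` to `D[T₁]`. -/
theorem exists_lift_gammaZ {z : ℂ} (hz : z ∈ cutPlane) (h : K) :
    ∃ u : FormSpace T₁.form, embed T₁.form u = bt.gammaZ z h ∧ bt.trace u = h := by
  obtain ⟨w, hw1, hw2, -⟩ := bt.exists_lift ((1 + z) • bt.gammaZ z h)
  refine ⟨bt.gamma h + w, ?_, ?_⟩
  · rw [map_add, hw1, ← gammaH_apply, ← bt.gammaZ_eq hz]
  · rw [map_add, hw2, trace_gamma, add_zero]

theorem Γ₀res_gammaZ {z : ℂ} (hz : z ∈ cutPlane) (h : K) :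
    bt.Γ₀res z ⟨bt.gammaZ z h, bt.gammaZ_mem hz h⟩ = h := by
  obtain ⟨u, hu1, hu2⟩ := bt.exists_lift_gammaZ hz h
  rw [bt.Γ₀res_eq (w := u) hu1, hu2]

-- Write u = a + c along the sum defining L. If Γ₀u = 0, then c lies in D[T₀] and is orthogonal to
-- itself, so c = 0. Thus u = a is a defect vector in dom T₀ and vanishes too.
omit [CompleteSpace K] in
theorem Γ₀res_injective {z : ℂ} (hz : z ∈ cutPlane) : Function.Injective (bt.Γ₀res z) := by
  refine (injective_iff_map_eq_zero _).mpr fun u hu => ?_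
  obtain ⟨a, ha, c, hc, hac⟩ := Submodule.mem_sup.mp u.2.2
  have hu0 : (u : H) ∈ T₀.form.dom := (bt.ker_eq _).mp hu
  have hc0 : c ∈ T₀.form.dom := by
    rw [← hac] at hu0
    exact ((T₀.form.dom.add_mem_iff_right (T₀.domain_le ha)).mp hu0)
  obtain ⟨hc1, h⟩ := hc
  have h1 := h ⟨c, hc1⟩ hc0
  have hcz : (⟨c, hc1⟩ : T₁.form.dom) = 0 :=
    (of T₁.form).map_eq_zero_iff.mp (inner_self_eq_zero (𝕜 := ℂ).mp h1)
  have hc' : c = 0 := congrArg Subtype.val hcz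
  rw [hc', add_zero] at hac
  rw [hac] at ha
  exact Subtype.ext (hp.eq_zero_of_mem_defectSpace hz ha u.2.1)

theorem Γ₀res_bijective {z : ℂ} (hz : z ∈ cutPlane) : Function.Bijective (bt.Γ₀res z) :=
  ⟨bt.Γ₀res_injective hz, fun h => ⟨_, bt.Γ₀res_gammaZ hz h⟩⟩

theorem gammaField_eq {z : ℂ} (hz : z ∈ cutPlane) (h : K) :
    bt.gammaField z h = ⟨bt.gammaZ z h, bt.gammaZ_mem hz h⟩ := by
  conv_lhs => rw [← bt.Γ₀res_gammaZ hz h]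
  exact Function.leftInverse_invFun (bt.Γ₀res_injective hz) _

theorem gammaZ_neg_one (h : K) : bt.gammaZ (-1) h = bt.gammaH h := by
  rw [bt.gammaZ_eq neg_one_mem_cutPlane]
  simp

/-- Green's identity with S*u = zu, rewritten in the inner product of D[T₁]. The test vector v stays
free: v = γg gives the bounded operator, v = u the quadratic form. -/
theorem inner_weyl {z : ℂ} (hz : z ∈ cutPlane) (h : K) {u : FormSpace T₁.form}
    (hu : embed T₁.form u = bt.gammaZ z h) (v : FormSpace T₁.form) :
    ⟪bt.weyl z h, bt.trace v⟫_ℂ =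
      (1 + conj z) * ⟪embed T₁.form u, embed T₁.form v⟫_ℂ - ⟪u, v⟫_ℂ := by
  have hm := bt.gammaZ_mem hz h
  have hg := bt.green ⟨bt.gammaZ z h, hm.2⟩ ((of T₁.form).symm v)
  rw [hp.adjoint_eq_smul_of_mem_defectSpace _ hm.1] at hg
  have hw : bt.weyl z h = bt.Γ₁ ⟨bt.gammaZ z h, hm.2⟩ := by
    rw [weyl, bt.gammaField_eq hz]
    rfl
  have hu' : u = of T₁.form (Submodule.inclusion hp.manifoldL_le_dom ⟨bt.gammaZ z h, hm.2⟩) :=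
    embed_injective hu
  have hi : ⟪u, v⟫_ℂ = T₁.form.val (Submodule.inclusion hp.manifoldL_le_dom
      ⟨bt.gammaZ z h, hm.2⟩) ((of T₁.form).symm v) + ⟪embed T₁.form u, embed T₁.form v⟫_ℂ := by
    rw [hu']
    rfl
  have h3 : ⟪z • bt.gammaZ z h, embed T₁.form v⟫_ℂ =
      conj z * ⟪embed T₁.form u, embed T₁.form v⟫_ℂ := by rw [inner_smul_left, hu]
  change _ = ⟪z • bt.gammaZ z h, embed T₁.form v⟫_ℂ - ⟪_, bt.trace v⟫_ℂ at hg
  rw [h3] at hg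
  rw [hi, hw]
  linear_combination hg

open ContinuousLinearMap in
/-- The Weyl function as a function with values in the bounded operators. -/
def weylOp (z : ℂ) : K →L[ℂ] K :=
  (1 + z) • (adjoint bt.gammaH ∘L bt.gammaZ z) - adjoint bt.gamma ∘L bt.gamma

theorem inner_weylOp (z : ℂ) (h g : K) : ⟪bt.weylOp z h, g⟫_ℂ =
    (1 + conj z) * ⟪bt.gammaZ z h, bt.gammaH g⟫_ℂ - ⟪bt.gamma h, bt.gamma g⟫_ℂ := by
  change ⟪(1 + z) • (ContinuousLinearMap.adjoint bt.gammaH (bt.gammaZ z h)) -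
    ContinuousLinearMap.adjoint bt.gamma (bt.gamma h), g⟫_ℂ = _
  rw [inner_sub_left, inner_smul_left, ContinuousLinearMap.adjoint_inner_left,
    ContinuousLinearMap.adjoint_inner_left, map_add, map_one]

/-- Tested against γg: `u - γh` has zero trace, so it is orthogonal to γg and ⟪u, γg⟫ may be
replaced by ⟪γh, γg⟫. -/
theorem weylOp_apply {z : ℂ} (hz : z ∈ cutPlane) (h : K) : bt.weylOp z h = bt.weyl z h := by
  refine ext_inner_right ℂ fun g => ?_
  obtain ⟨u, hu1, hu2⟩ := bt.exists_lift_gammaZ hz h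
  have h1 := bt.inner_weyl hz h hu1 (bt.gamma g)
  have h2 := bt.inner_gamma_right g (v := u - bt.gamma h)
    (by rw [map_sub, hu2, trace_gamma, sub_self])
  rw [inner_sub_left] at h2
  rw [trace_gamma] at h1
  rw [h1, inner_weylOp, hu1, ← gammaH_apply]
  linear_combination h2

end BoundaryTriplet

namespace BoundaryTriplet

variable {H : Type*} [NormedAddCommGroup H] [InnerProductSpace ℂ H] [CompleteSpace H]
  {K : Type*} [NormedAddCommGroup K] [InnerProductSpace ℂ K] [CompleteSpace K]
  {S : H →ₗ.[ℂ] H} {T₀ T₁ : NonnegSAOp H} {hp : SpecialPair S T₀ T₁}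
  (bt : BoundaryTriplet hp K)

/-! ### The difference of the resolvents -/

/-- The difference of the resolvents at `-1` as an operator with values in `D[T₁] ⊖ D[T₀]`. -/
theorem exists_lift_diff (f : H) : ∃ a : FormSpace T₁.form,
    embed T₁.form a = T₁.resolventOne f - T₀.resolventOne f ∧
    (∀ g, ⟪bt.gamma g, a⟫_ℂ = ⟪bt.gammaH g, f⟫_ℂ) ∧
    bt.gamma (bt.trace a) = a ∧
    ⟪T₁.resolventOne f - T₀.resolventOne f, f⟫_ℂ = ((‖a‖ ^ 2 : ℝ) : ℂ) := by
  obtain ⟨w, hw1, hw2, hw3⟩ := bt.exists_lift f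
  set r := ContinuousLinearMap.adjoint (embed T₁.form) f with hr
  have hE : embed T₁.form (r - w) = T₁.resolventOne f - T₀.resolventOne f := by
    rw [map_sub, hw1, T₁.embed_adjoint_embed]
  -- Both `r` and `w` represent v ↦ (f, v) on D[T₀], so their difference is orthogonal to D[T₀].
  have horth : ∀ v, bt.trace v = 0 → ⟪r - w, v⟫_ℂ = 0 := fun v hv => by
    rw [inner_sub_left, hw3 v hv, hr, ContinuousLinearMap.adjoint_inner_left, sub_self]
  -- Both sides have the same trace and are orthogonal to the kernel of the trace, so their
  -- difference is orthogonal to itself.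
  have hgt : bt.gamma (bt.trace (r - w)) = r - w := by
    have h0 : bt.trace (bt.gamma (bt.trace (r - w)) - (r - w)) = 0 := by
      rw [map_sub, trace_gamma, sub_self]
    rw [← sub_eq_zero, ← inner_self_eq_zero (𝕜 := ℂ)]
    nth_rewrite 1 [inner_sub_left]
    rw [bt.inner_gamma_left _ h0, horth _ h0, sub_self]
  refine ⟨r - w, hE, fun g => ?_, hgt, ?_⟩
  · rw [inner_sub_right, bt.inner_gamma_left g hw2, sub_zero, hr,
      ContinuousLinearMap.adjoint_inner_right, gammaH_apply]
  · rw [← hE, ← ContinuousLinearMap.adjoint_inner_right, ← hr]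
    have h1 := horth w hw2
    have h2 : ⟪r - w, r - w⟫_ℂ = ⟪r - w, r⟫_ℂ - ⟪r - w, w⟫_ℂ := inner_sub_right _ _ _
    rw [h1, sub_zero] at h2
    rw [← h2, inner_self_eq_norm_sq_to_K]
    simp

-- Nonnegativity is what makes `rootDiff` a genuine square root: `CFC.sqrt` takes the default value
-- 0 on operators that are not nonnegative.
include bt in
theorem cayley_sub_nonneg : 0 ≤ T₁.cayley - T₀.cayley := by
  have h : T₁.cayley - T₀.cayley = (2 : ℂ) • (T₁.resolventOne - T₀.resolventOne) := by
    simp only [NonnegSAOp.cayley, smul_sub]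
    abel
  rw [h, ContinuousLinearMap.nonneg_iff_isPositive]
  refine ContinuousLinearMap.IsPositive.smul_of_nonneg ?_ (by norm_num [Complex.le_def])
  rw [ContinuousLinearMap.isPositive_def']
  refine ⟨T₁.resolventOne_isPositive.isSelfAdjoint.sub T₀.resolventOne_isPositive.isSelfAdjoint,
    fun f => ?_⟩
  obtain ⟨a, -, -, -, ha⟩ := bt.exists_lift_diff f
  change 0 ≤ (⟪T₁.resolventOne f - T₀.resolventOne f, f⟫_ℂ).re
  rw [ha, Complex.ofReal_re]
  positivity

include bt in
theorem rootDiff_rootDiff (f : H) : rootDiff T₀ T₁ (rootDiff T₀ T₁ f) =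
    (2 : ℂ) • (T₁.resolventOne f - T₀.resolventOne f) := by
  have h := congrArg (fun A : H →L[ℂ] H => A f)
    (CFC.sqrt_mul_sqrt_self (T₁.cayley - T₀.cayley) bt.cayley_sub_nonneg)
  refine Eq.trans h ?_
  change (-f + (2 : ℂ) • T₁.resolventOne f) - (-f + (2 : ℂ) • T₀.resolventOne f) = _
  module

end BoundaryTriplet

section RootDiff

variable {H : Type*} [NormedAddCommGroup H] [InnerProductSpace ℂ H] [CompleteSpace H]
  (T₀ T₁ : NonnegSAOp H)

theorem rootDiff_isSelfAdjoint : IsSelfAdjoint (rootDiff T₀ T₁) :=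
  (CFC.sqrt_nonneg _).isSelfAdjoint

theorem rootDiff_symm (f g : H) : ⟪rootDiff T₀ T₁ f, g⟫_ℂ = ⟪f, rootDiff T₀ T₁ g⟫_ℂ :=
  ContinuousLinearMap.isSelfAdjoint_iff_isSymmetric.mp (rootDiff_isSelfAdjoint T₀ T₁) f g

theorem adjoint_rootDiff : ContinuousLinearMap.adjoint (rootDiff T₀ T₁) = rootDiff T₀ T₁ :=
  rootDiff_isSelfAdjoint T₀ T₁

end RootDiff

/-! ### Comparison of (B₁ - B₀)^{1/2} with Γ₀(-1), and the homeomorphism X₀ -/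

namespace BoundaryTriplet

variable {H : Type*} [NormedAddCommGroup H] [InnerProductSpace ℂ H] [CompleteSpace H]
  {K : Type*} [NormedAddCommGroup K] [InnerProductSpace ℂ K] [CompleteSpace K]
  {S : H →ₗ.[ℂ] H} {T₀ T₁ : NonnegSAOp H} {hp : SpecialPair S T₀ T₁}
  (bt : BoundaryTriplet hp K)

include bt in
theorem norm_rootDiff_sq {f : H} {a : FormSpace T₁.form}
    (ha : ⟪T₁.resolventOne f - T₀.resolventOne f, f⟫_ℂ = ((‖a‖ ^ 2 : ℝ) : ℂ)) :
    ‖rootDiff T₀ T₁ f‖ ^ 2 = 2 * ‖a‖ ^ 2 := by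
  have h1 : (⟪rootDiff T₀ T₁ f, rootDiff T₀ T₁ f⟫_ℂ).re = ‖rootDiff T₀ T₁ f‖ ^ 2 :=
    inner_self_eq_norm_sq (𝕜 := ℂ) _
  rw [← h1, ← rootDiff_symm, bt.rootDiff_rootDiff, inner_smul_left, ha, map_ofNat,
    ← Complex.ofReal_ofNat, ← Complex.ofReal_mul, Complex.ofReal_re]

theorem adjoint_gammaH_apply {f : H} {a : FormSpace T₁.form}
    (ha : ∀ g, ⟪bt.gamma g, a⟫_ℂ = ⟪bt.gammaH g, f⟫_ℂ) :
    ContinuousLinearMap.adjoint bt.gammaH f = ContinuousLinearMap.adjoint bt.gamma a :=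
  ext_inner_left ℂ fun g => by
    rw [ContinuousLinearMap.adjoint_inner_right, ContinuousLinearMap.adjoint_inner_right, ha]

/-- Both sides are governed by the lift a of the resolvent difference: Γ₀(-1)*f = γ*a, while (B₁ -
B₀)^{1/2}f has norm √2‖a‖. This is the hypothesis of Douglas' lemma. -/
theorem norm_adjoint_gammaH_le (f : H) : ‖ContinuousLinearMap.adjoint bt.gammaH f‖ ≤
    ‖ContinuousLinearMap.adjoint bt.gamma‖ * ‖ContinuousLinearMap.adjoint (rootDiff T₀ T₁) f‖ := by
  obtain ⟨a, -, ha, -, hn⟩ := bt.exists_lift_diff f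
  rw [adjoint_rootDiff, bt.adjoint_gammaH_apply ha]
  refine (ContinuousLinearMap.le_opNorm _ _).trans ?_
  gcongr
  refine le_of_sq_le_sq ?_ (norm_nonneg _)
  rw [bt.norm_rootDiff_sq hn]
  nlinarith [sq_nonneg ‖a‖]

theorem norm_rootDiff_le (f : H) : ‖ContinuousLinearMap.adjoint (rootDiff T₀ T₁) f‖ ≤
    (2 * ‖bt.trace‖) * ‖ContinuousLinearMap.adjoint bt.gammaH f‖ := by
  obtain ⟨a, -, ha, hgt, hn⟩ := bt.exists_lift_diff f
  rw [adjoint_rootDiff, bt.adjoint_gammaH_apply ha]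
  -- γ* is bounded below at a because a = γ(trace a), whence ‖a‖² = ⟪trace a, γ*a⟫.
  have h1 : ‖a‖ ≤ ‖bt.trace‖ * ‖ContinuousLinearMap.adjoint bt.gamma a‖ := by
    have h2 : (⟪a, a⟫_ℂ).re = ‖a‖ ^ 2 := inner_self_eq_norm_sq (𝕜 := ℂ) a
    have h3 : ⟪a, a⟫_ℂ = ⟪bt.trace a, ContinuousLinearMap.adjoint bt.gamma a⟫_ℂ := by
      rw [ContinuousLinearMap.adjoint_inner_right, hgt]
    have h4 : ‖a‖ ^ 2 ≤ ‖bt.trace‖ * ‖a‖ * ‖ContinuousLinearMap.adjoint bt.gamma a‖ := by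
      rw [← h2, h3]
      refine (Complex.re_le_norm _).trans ((norm_inner_le_norm _ _).trans ?_)
      gcongr
      exact bt.trace.le_opNorm a
    by_contra! hlt
    have ha0 : 0 < ‖a‖ := lt_of_le_of_lt (by positivity) hlt
    nlinarith
  have h5 : ‖rootDiff T₀ T₁ f‖ ≤ 2 * ‖a‖ := by
    refine le_of_sq_le_sq ?_ (by positivity)
    rw [bt.norm_rootDiff_sq hn]
    nlinarith [sq_nonneg ‖a‖]
  linarith

include bt in
/-- `(B₁ - B₀)^{1/2}` is injective on the defect subspace `N_{-1}`. -/
theorem eq_zero_of_rootDiff_eq_zero {y : H} (hy : y ∈ defectSpace S (-1))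
    (h : rootDiff T₀ T₁ y = 0) : y = 0 := by
  have h1 := bt.rootDiff_rootDiff y
  rw [h, map_zero] at h1
  have h2 : T₁.resolventOne y = T₀.resolventOne y := by
    rw [← sub_eq_zero]
    exact (smul_eq_zero.mp h1.symm).resolve_left two_ne_zero
  -- The common value of the two resolvents lies in dom T₀ ∩ dom T₁ = dom S, so y is in ran(S + I),
  -- to which it is also orthogonal.
  have hS : T₀.resolventOne y ∈ S.domain := by
    rw [← hp.disjoint]
    exact ⟨T₀.resolventOne_mem y, h2 ▸ T₁.resolventOne_mem y⟩
  have h3 : S ⟨_, hS⟩ = T₀.op ⟨_, T₀.resolventOne_mem y⟩ := hp.le₀.2 rfl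
  have h4 := mem_defectSpace_iff.mp hy ⟨_, hS⟩
  have h5 := T₀.op_resolventOne y
  rw [← h3] at h5
  have h6 := congrArg (fun x => ⟪x, y⟫_ℂ) h5
  simp only [inner_add_left] at h6
  rw [← inner_self_eq_zero (𝕜 := ℂ), ← h6, h4]
  ring

/-- The solution in `N_{-1}` of `(B₁ - B₀)^{1/2} y = Γ₀(-1) h`. -/
theorem exists_rootDiff_eq (h : K) : ∃ y : defectSpace S (-1),
    rootDiff T₀ T₁ y = bt.gammaH h ∧
      ‖y‖ ≤ ‖ContinuousLinearMap.adjoint bt.gamma‖ * ‖h‖ := by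
  obtain ⟨y, hy1, hy2⟩ := exists_preimage_of_norm_adjoint_le bt.gammaH (rootDiff T₀ T₁)
    (norm_nonneg _) bt.norm_adjoint_gammaH_le h
  -- Only the component in N₋₁ matters: the root is symmetric with range in N₋₁, so it kills the
  -- orthogonal complement.
  obtain ⟨p, hpm, q, hq, hpq⟩ := (defectSpace S (-1)).exists_add_mem_mem_orthogonal y
  have hq0 : rootDiff T₀ T₁ q = 0 := by
    rw [← inner_self_eq_zero (𝕜 := ℂ), rootDiff_symm]
    exact (Submodule.mem_orthogonal' _ _).mp hq _ (hp.rootDiff_mem _)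
  refine ⟨⟨p, hpm⟩, ?_, ?_⟩
  · rw [← hy1, hpq, map_add, hq0, add_zero]
  · refine le_trans ?_ hy2
    refine le_of_sq_le_sq ?_ (norm_nonneg _)
    have := norm_add_sq_eq_norm_sq_add_norm_sq_of_inner_eq_zero (𝕜 := ℂ) p q
      ((Submodule.mem_orthogonal _ _).mp hq p hpm)
    rw [hpq]
    change ‖p‖ ^ 2 ≤ _
    nlinarith [mul_self_nonneg ‖q‖]

/-- The homeomorphism `X₀` with `Γ₀(-1) = (B₁ - B₀)^{1/2} X₀`. -/
theorem exists_equiv : ∃ X₀ : K ≃L[ℂ] defectSpace S (-1),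
    ∀ h, rootDiff T₀ T₁ (X₀ h) = bt.gammaH h := by
  choose X hX hn using bt.exists_rootDiff_eq
  -- Uniqueness of solutions in N₋₁ forces the pointwise choice `X` to be linear.
  have huniq : ∀ y y' : defectSpace S (-1), rootDiff T₀ T₁ y = rootDiff T₀ T₁ y' → y = y' :=
    fun y y' h => by
      rw [← sub_eq_zero]
      refine Subtype.ext (bt.eq_zero_of_rootDiff_eq_zero (y - y').2 ?_)
      rw [Submodule.coe_sub, map_sub, h, sub_self]
  let Xl : K →ₗ[ℂ] defectSpace S (-1) :=
    { toFun := X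
      map_add' := fun h g => huniq _ _ (by
        rw [Submodule.coe_add, map_add, hX, hX, hX, map_add])
      map_smul' := fun c h => huniq _ _ (by
        rw [RingHom.id_apply, Submodule.coe_smul, map_smul, hX, hX, map_smul]) }
  let Xc : K →L[ℂ] defectSpace S (-1) := Xl.mkContinuous _ hn
  have hinj : Function.Injective Xc := by
    refine (injective_iff_map_eq_zero Xc).mpr fun h h0 => ?_
    have h1 := hX h
    have h2 : X h = 0 := h0
    rw [h2, Submodule.coe_zero, map_zero, gammaH_apply] at h1
    have h3 : bt.gamma h = 0 := embed_injective (by rw [← h1, map_zero])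
    rw [← bt.trace_gamma h, h3, map_zero]
  have hsurj : Function.Surjective Xc := fun y => by
    -- Douglas' lemma with the roles exchanged: the range of the root is contained in that of
    -- Γ₀(-1).
    obtain ⟨h, hh, -⟩ := exists_preimage_of_norm_adjoint_le (rootDiff T₀ T₁) bt.gammaH
      (by positivity) bt.norm_rootDiff_le (y : H)
    exact ⟨h, huniq _ _ ((hX h).trans hh)⟩
  exact ⟨ContinuousLinearEquiv.ofBijective Xc (LinearMap.ker_eq_bot.mpr hinj)
    (LinearMap.range_eq_top.mpr hsurj), hX⟩

/-! ### The formulas for the Weyl function -/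

variable {X₀ : K ≃L[ℂ] defectSpace S (-1)}

open ContinuousLinearMap in
/-- `Γ₀(-1)` is `√2` times an isometry in terms of `X₀`. -/
theorem inner_gamma_gamma (hX : ∀ h, rootDiff T₀ T₁ (X₀ h) = bt.gammaH h) (h g : K) :
    ⟪bt.gamma h, bt.gamma g⟫_ℂ = 2 * ⟪X₀ h, X₀ g⟫_ℂ := by
  -- The case X₀g = (B₁ - B₀)^{1/2}f: applying the root once more gives twice the resolvent
  -- difference, so γg = 2a.
  have key : ∀ f : H, ⟪bt.gamma h, bt.gamma (X₀.symm ⟨_, hp.rootDiff_mem f⟩)⟫_ℂ =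
      2 * ⟪(X₀ h : H), rootDiff T₀ T₁ f⟫_ℂ := fun f => by
    obtain ⟨a, ha1, ha2, -, -⟩ := bt.exists_lift_diff f
    have h1 : bt.gamma (X₀.symm ⟨_, hp.rootDiff_mem f⟩) = (2 : ℂ) • a := by
      refine embed_injective ?_
      rw [← gammaH_apply, ← hX, ContinuousLinearEquiv.apply_symm_apply, bt.rootDiff_rootDiff,
        map_smul, ha1]
    rw [h1, inner_smul_right, ha2, ← hX, rootDiff_symm]
  let X : K →L[ℂ] defectSpace S (-1) := X₀
  let Y : defectSpace S (-1) →L[ℂ] K := X₀.symm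
  -- Extension to all g: the defect `q` of the identity is orthogonal to the range of the root, so
  -- the root annihilates it, and the root is injective on N₋₁.
  have hp0 : (adjoint Y (adjoint bt.gamma (bt.gamma h) - (2 : ℂ) • adjoint X (X₀ h)) : H) = 0 := by
    set q := adjoint Y (adjoint bt.gamma (bt.gamma h) - (2 : ℂ) • adjoint X (X₀ h)) with hq
    have hqf : ∀ f, ⟪(q : H), rootDiff T₀ T₁ f⟫_ℂ = 0 := fun f => by
      change ⟪q, (⟨_, hp.rootDiff_mem f⟩ : defectSpace S (-1))⟫_ℂ = 0
      rw [hq, adjoint_inner_left, inner_sub_left, adjoint_inner_left, inner_smul_left,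
        adjoint_inner_left, map_ofNat]
      change ⟪bt.gamma h, bt.gamma (X₀.symm ⟨_, hp.rootDiff_mem f⟩)⟫_ℂ -
        2 * ⟪X₀ h, X₀ (X₀.symm ⟨_, hp.rootDiff_mem f⟩)⟫_ℂ = 0
      rw [key, ContinuousLinearEquiv.apply_symm_apply]
      exact sub_self _
    refine bt.eq_zero_of_rootDiff_eq_zero q.2 ?_
    rw [← inner_self_eq_zero (𝕜 := ℂ), rootDiff_symm]
    exact hqf _
  have h2 := congrArg (fun q => ⟪q, X₀ g⟫_ℂ) (Subtype.ext hp0 :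
    adjoint Y (adjoint bt.gamma (bt.gamma h) - (2 : ℂ) • adjoint X (X₀ h)) = 0)
  have h3 : Y (X₀ g) = g := X₀.symm_apply_apply g
  simp only [adjoint_inner_left, h3, inner_sub_left, inner_smul_left, map_ofNat,
    inner_zero_left] at h2
  exact sub_eq_zero.mp h2

/-- The resolvent of B₀ is -(1 + z)/2 times `transfer z`, which carries (B₁ - B₀)^{1/2}X₀h to
Γ₀(z)h. The other root moves to X₀g, and the identity term matches -γ*γ by `inner_gamma_gamma`. -/
theorem inner_qOperator (hX : ∀ h, rootDiff T₀ T₁ (X₀ h) = bt.gammaH h) {z : ℂ}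
    (hz : z ∈ cutPlane) (hz1 : z ≠ -1) (h g : K) :
    (-2 : ℂ) * ⟪qOperator T₀ T₁ ((1 - z) / (1 + z)) (X₀ h), (X₀ g : H)⟫_ℂ =
      ⟪bt.weylOp z h, g⟫_ℂ := by
  have hQ : qOperator T₀ T₁ ((1 - z) / (1 + z)) (X₀ h) =
      (X₀ h : H) + (-(1 + z) / 2) • rootDiff T₀ T₁ (bt.gammaZ z h) := by
    rw [qOperator, NonnegSAOp.inverse_cayley_sub_smul hz hz1]
    change (X₀ h : H) + rootDiff T₀ T₁ ((-(1 + z) / 2) • T₀.transfer z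
      (rootDiff T₀ T₁ (X₀ h))) = _
    rw [map_smul, hX]
    rfl
  rw [hQ, inner_weylOp, bt.inner_gamma_gamma hX, inner_add_left, inner_smul_left, rootDiff_symm,
    hX, Submodule.coe_inner]
  simp only [map_div₀, map_neg, map_add, map_one, map_ofNat]
  ring

theorem weylOp_eq_qOperator (hX : ∀ h, rootDiff T₀ T₁ (X₀ h) = bt.gammaH h) {z : ℂ}
    (hz : z ∈ cutPlane) (hz1 : z ≠ -1) : bt.weylOp z = (-2 : ℂ) •
      (ContinuousLinearMap.adjoint ((defectSpace S (-1)).subtypeL ∘L (X₀ : K →L[ℂ] _)) ∘L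
        qOperator T₀ T₁ ((1 - z) / (1 + z)) ∘L
          ((defectSpace S (-1)).subtypeL ∘L (X₀ : K →L[ℂ] _))) := by
  refine ContinuousLinearMap.ext fun h => ext_inner_right ℂ fun g => ?_
  rw [← bt.inner_qOperator hX hz hz1, smul_apply, inner_smul_left,
    ContinuousLinearMap.comp_apply, ContinuousLinearMap.adjoint_inner_left]
  simp only [map_neg, map_ofNat]
  rfl

theorem weylOp_eq_qFunction (hX : ∀ h, rootDiff T₀ T₁ (X₀ h) = bt.gammaH h) {z : ℂ}
    (hz : z ∈ cutPlane) (hz1 : z ≠ -1) : bt.weylOp z = (-2 : ℂ) •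
      (ContinuousLinearMap.adjoint (X₀ : K →L[ℂ] defectSpace S (-1)) ∘L
        qFunction hp ((1 - z) / (1 + z)) ∘L (X₀ : K →L[ℂ] defectSpace S (-1))) := by
  refine ContinuousLinearMap.ext fun h => ext_inner_right ℂ fun g => ?_
  rw [← bt.inner_qOperator hX hz hz1, smul_apply, inner_smul_left,
    ContinuousLinearMap.comp_apply, ContinuousLinearMap.adjoint_inner_left]
  simp only [map_neg, map_ofNat]
  rfl

theorem weylOp_neg_one (hX : ∀ h, rootDiff T₀ T₁ (X₀ h) = bt.gammaH h) :
    bt.weylOp (-1) = (-2 : ℂ) • (ContinuousLinearMap.adjoint (X₀ : K →L[ℂ] defectSpace S (-1)) ∘L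
      (X₀ : K →L[ℂ] defectSpace S (-1))) := by
  refine ContinuousLinearMap.ext fun h => ext_inner_right ℂ fun g => ?_
  rw [inner_weylOp, bt.inner_gamma_gamma hX, smul_apply, inner_smul_left,
    ContinuousLinearMap.comp_apply, ContinuousLinearMap.adjoint_inner_left]
  simp [map_ofNat (starRingEnd ℂ) 2]

end BoundaryTriplet

namespace BoundaryTriplet

variable {H : Type*} [NormedAddCommGroup H] [InnerProductSpace ℂ H] [CompleteSpace H]
  {K : Type*} [NormedAddCommGroup K] [InnerProductSpace ℂ K] [CompleteSpace K]
  {S : H →ₗ.[ℂ] H} {T₀ T₁ : NonnegSAOp H} {hp : SpecialPair S T₀ T₁}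
  (bt : BoundaryTriplet hp K)

/-! ### Analytic properties of the Weyl function -/

theorem inner_weylOp_trace {z : ℂ} (hz : z ∈ cutPlane) {h : K} {u : FormSpace T₁.form}
    (hu : embed T₁.form u = bt.gammaZ z h) (v : FormSpace T₁.form) :
    ⟪bt.weylOp z h, bt.trace v⟫_ℂ =
      (1 + conj z) * ⟪embed T₁.form u, embed T₁.form v⟫_ℂ - ⟪u, v⟫_ℂ := by
  rw [bt.weylOp_apply hz, bt.inner_weyl hz h hu]

/-- Since ‖u‖² - ‖embed u‖² = T₁[u], the right side is z̄‖embed u‖² - T₁[u]. -/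
theorem inner_weylOp_self {z : ℂ} (hz : z ∈ cutPlane) {h : K} {u : FormSpace T₁.form}
    (hu : embed T₁.form u = bt.gammaZ z h) (hu' : bt.trace u = h) :
    ⟪bt.weylOp z h, h⟫_ℂ =
      (1 + conj z) * ((‖embed T₁.form u‖ ^ 2 : ℝ) : ℂ) - ((‖u‖ ^ 2 : ℝ) : ℂ) := by
  have h1 := bt.inner_weylOp_trace hz hu u
  rw [hu', inner_self_eq_norm_sq_to_K, inner_self_eq_norm_sq_to_K] at h1
  rw [h1]
  simp

theorem differentiableOn_weylOp : DifferentiableOn ℂ bt.weylOp cutPlane := by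
  have h1 : DifferentiableOn ℂ
      (fun z => ContinuousLinearMap.adjoint bt.gammaH ∘L bt.gammaZ z) cutPlane :=
    (differentiableOn_const _).clm_comp
      (NonnegSAOp.differentiableOn_transfer.clm_comp (differentiableOn_const _))
  have h2 : DifferentiableOn ℂ (fun z : ℂ => 1 + z) cutPlane := by fun_prop
  exact (h2.smul h1).sub_const _

theorem weylOp_conj (z : ℂ) : bt.weylOp (conj z) = ContinuousLinearMap.adjoint (bt.weylOp z) := by
  refine ContinuousLinearMap.ext fun h => ext_inner_right ℂ fun g => ?_
  rw [ContinuousLinearMap.adjoint_inner_left, ← inner_conj_symm h, inner_weylOp, inner_weylOp,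
    map_sub, map_mul, inner_conj_symm, inner_conj_symm, map_add, map_one, gammaZ, gammaZ,
    ← NonnegSAOp.adjoint_transfer, ContinuousLinearMap.comp_apply, ContinuousLinearMap.comp_apply,
    ContinuousLinearMap.adjoint_inner_left]

theorem im_inner_weylOp_nonneg {z : ℂ} (hz : 0 < z.im) (g : K) :
    0 ≤ (⟪g, bt.weylOp z g⟫_ℂ).im := by
  have hc : z ∈ cutPlane := by
    rintro ⟨x, -, rfl⟩
    exact absurd hz (by simp)
  obtain ⟨u, hu1, hu2⟩ := bt.exists_lift_gammaZ hc g
  rw [← inner_conj_symm, bt.inner_weylOp_self hc hu1 hu2, Complex.conj_im, Complex.sub_im,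
    Complex.ofReal_im, Complex.im_mul_ofReal, Complex.add_im, Complex.one_im, Complex.conj_im]
  have := mul_nonneg hz.le (sq_nonneg ‖embed T₁.form u‖)
  linarith

/-- Coercivity: -(M(z)h, h) = s - z̄r with s = T₁[u], r the squared H-norm of u, and s + r = ‖u‖²,
which dominates a multiple of ‖h‖² because h is the trace of u. The added 1 keeps the denominator
positive if the trace is zero. -/
theorem isUnit_weylOp {z : ℂ} (hz : z ∈ cutPlane) : IsUnit (bt.weylOp z) := by
  obtain ⟨c, hc, hcz⟩ := exists_le_norm_sub_mul (cutPlane_conj hz)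
  refine isUnit_of_coercive _ (c := c / (‖bt.trace‖ + 1) ^ 2) (by positivity) fun h => ?_
  obtain ⟨u, hu1, hu2⟩ := bt.exists_lift_gammaZ hz h
  have h1 : ‖h‖ ≤ (‖bt.trace‖ + 1) * ‖u‖ := by
    rw [← hu2]
    refine (bt.trace.le_opNorm u).trans ?_
    gcongr
    linarith
  have hle : ‖embed T₁.form u‖ ^ 2 ≤ ‖u‖ ^ 2 := by
    gcongr
    exact norm_embed_le u
  have h2 := hcz (‖u‖ ^ 2 - ‖embed T₁.form u‖ ^ 2) (‖embed T₁.form u‖ ^ 2) (by linarith)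
    (by positivity)
  have h3 : ⟪bt.weylOp z h, h⟫_ℂ = -(((‖u‖ ^ 2 - ‖embed T₁.form u‖ ^ 2 : ℝ) : ℂ) -
      conj z * ((‖embed T₁.form u‖ ^ 2 : ℝ) : ℂ)) := by
    rw [bt.inner_weylOp_self hz hu1 hu2]
    push_cast
    ring
  rw [h3, norm_neg]
  refine le_trans ?_ h2
  rw [sub_add_cancel, div_mul_eq_mul_div, div_le_iff₀ (by positivity), mul_assoc]
  gcongr
  calc ‖h‖ ^ 2 ≤ ((‖bt.trace‖ + 1) * ‖u‖) ^ 2 := by gcongr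
    _ = ‖u‖ ^ 2 * (‖bt.trace‖ + 1) ^ 2 := by ring

/-! ### Limits along the negative half-line -/

/-- The quadratic form of `-M(x)`. -/
def quad (x : ℝ) (h : K) : ℝ := -(⟪bt.weylOp x h, h⟫_ℂ).re

variable {x : ℝ}

theorem quad_eq (hx : x < 0) {h : K} {u : FormSpace T₁.form}
    (hu : embed T₁.form u = bt.gammaZ x h) (hu' : bt.trace u = h) :
    bt.quad x h = ‖u‖ ^ 2 - (1 + x) * ‖embed T₁.form u‖ ^ 2 := by
  rw [quad, bt.inner_weylOp_self (ofReal_mem_cutPlane hx) hu hu', Complex.conj_ofReal,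
    Complex.sub_re, Complex.re_mul_ofReal, Complex.ofReal_re, Complex.add_re, Complex.one_re,
    Complex.ofReal_re]
  ring

omit [CompleteSpace K] in
theorem energy_nonneg (hx : x < 0) (u : FormSpace T₁.form) :
    0 ≤ ‖u‖ ^ 2 - (1 + x) * ‖embed T₁.form u‖ ^ 2 := by
  have hle : ‖embed T₁.form u‖ ^ 2 ≤ ‖u‖ ^ 2 := by
    gcongr
    exact norm_embed_le u
  nlinarith [sq_nonneg ‖embed T₁.form u‖]

theorem quad_nonneg (hx : x < 0) (h : K) : 0 ≤ bt.quad x h := by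
  obtain ⟨u, hu1, hu2⟩ := bt.exists_lift_gammaZ (ofReal_mem_cutPlane hx) h
  rw [bt.quad_eq hx hu1 hu2]
  exact energy_nonneg hx u

/-- The minimum property of the Weyl function. -/
theorem quad_le (hx : x < 0) {h : K} {v : FormSpace T₁.form} (hv : bt.trace v = h) :
    bt.quad x h ≤ ‖v‖ ^ 2 - (1 + x) * ‖embed T₁.form v‖ ^ 2 := by
  obtain ⟨u, hu1, hu2⟩ := bt.exists_lift_gammaZ (ofReal_mem_cutPlane hx) h
  have h1 := congrArg Complex.re (bt.inner_weylOp_trace (ofReal_mem_cutPlane hx) hu1 v)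
  have h2 := bt.quad_eq hx hu1 hu2
  -- In the energy of u - v the cross term equals -2 `quad x h`, since v has trace h, and the energy
  -- of u is `quad x h` itself.
  have h3 := energy_nonneg hx (u - v)
  have h4 : ‖u - v‖ ^ 2 = ‖u‖ ^ 2 - 2 * (⟪u, v⟫_ℂ).re + ‖v‖ ^ 2 := norm_sub_sq (𝕜 := ℂ) u v
  have h5 : ‖embed T₁.form u - embed T₁.form v‖ ^ 2 = ‖embed T₁.form u‖ ^ 2 -
    2 * (⟪embed T₁.form u, embed T₁.form v⟫_ℂ).re + ‖embed T₁.form v‖ ^ 2 :=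
    norm_sub_sq (𝕜 := ℂ) _ _
  have h6 : (1 + conj (x : ℂ)) = ((1 + x : ℝ) : ℂ) := by simp
  rw [hv, h6, Complex.sub_re, Complex.re_ofReal_mul] at h1
  rw [map_sub, h4, h5] at h3
  rw [quad] at h2 ⊢
  linarith

theorem isPositive_neg_weylOp (hx : x < 0) : (-bt.weylOp x).IsPositive := by
  rw [ContinuousLinearMap.isPositive_def']
  refine ⟨IsSelfAdjoint.neg ?_, fun h => ?_⟩
  · have h := bt.weylOp_conj x
    rw [Complex.conj_ofReal] at h
    exact h.symm
  · change 0 ≤ (⟪-(bt.weylOp x h), h⟫_ℂ).re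
    rw [inner_neg_left, Complex.neg_re]
    exact bt.quad_nonneg hx h

/-- Turns convergence of the quadratic form at a single vector into strong convergence, given a
bound on the form. -/
theorem norm_sq_weylOp_le (hx : x < 0) {C : ℝ} (hC : ∀ h, bt.quad x h ≤ C * ‖h‖ ^ 2) (h : K) :
    ‖bt.weylOp x h‖ ^ 2 ≤ C * bt.quad x h := by
  have hq : ∀ h, (⟪(-bt.weylOp x) h, h⟫_ℂ).re = bt.quad x h := fun h => by
    change (⟪-(bt.weylOp x h), h⟫_ℂ).re = _
    rw [inner_neg_left, Complex.neg_re, quad]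
  have h1 := norm_sq_apply_le_of_isPositive (bt.isPositive_neg_weylOp hx)
    (C := C) (fun h => by rw [hq]; exact hC h) h
  rw [hq] at h1
  simpa using h1

theorem norm_sq_gamma_le (h : K) : ‖bt.gamma h‖ ^ 2 ≤ ‖bt.gamma‖ ^ 2 * ‖h‖ ^ 2 := by
  rw [← mul_pow]
  gcongr
  exact bt.gamma.le_opNorm h

theorem quad_le_of_neg_one_le (hx : x < 0) (hx1 : -1 ≤ x) (h : K) :
    bt.quad x h ≤ ‖bt.gamma‖ ^ 2 * ‖h‖ ^ 2 := by
  refine (bt.quad_le hx (bt.trace_gamma h)).trans (le_trans ?_ (bt.norm_sq_gamma_le h))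
  nlinarith [sq_nonneg ‖embed T₁.form (bt.gamma h)‖]

theorem quad_le_of_le_neg_one (hx1 : x ≤ -1) (h : K) :
    bt.quad x h ≤ (-x * ‖bt.gamma‖ ^ 2) * ‖h‖ ^ 2 := by
  have h1 := bt.quad_le (by linarith : x < 0) (bt.trace_gamma h)
  have h2 := bt.norm_sq_gamma_le h
  have hle : ‖embed T₁.form (bt.gamma h)‖ ^ 2 ≤ ‖bt.gamma h‖ ^ 2 := by
    gcongr
    exact norm_embed_le _
  nlinarith [mul_le_mul_of_nonneg_left h2 (by linarith : 0 ≤ -x)]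

/-- The extremality condition supplies a trial vector w = γg - φ with T₁[w] < b, and the energy of w
tends to T₁[w] as x ↑ 0. -/
theorem tendsto_quad_zero (he : ExtremalPair S T₀ T₁) (g : K) :
    Tendsto (fun x : ℝ => bt.quad x g) (𝓝[<] 0) (𝓝 0) := by
  refine tendsto_order.mpr ⟨fun a ha => ?_, fun b hb => ?_⟩
  · filter_upwards [self_mem_nhdsWithin] with x hx
    exact ha.trans_le (bt.quad_nonneg hx g)
  · obtain ⟨_, ⟨φ, hφ, rfl⟩, hr⟩ := (he.approx ((of T₁.form).symm (bt.gamma g))).exists_between hb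
    set w : T₁.form.dom := (of T₁.form).symm (bt.gamma g) - φ
    have hv : bt.trace (of T₁.form w) = g := by
      have h0 : bt.trace (of T₁.form φ) = 0 := bt.trace_eq_zero_iff.mpr hφ
      rw [map_sub, map_sub, h0, sub_zero, LinearEquiv.apply_symm_apply, trace_gamma]
    have hc : Tendsto (fun x : ℝ => ‖of T₁.form w‖ ^ 2 - (1 + x) * ‖(w : H)‖ ^ 2) (𝓝[<] 0)
        (𝓝 (‖of T₁.form w‖ ^ 2 - (1 + 0) * ‖(w : H)‖ ^ 2)) := by
      refine Tendsto.mono_left ?_ nhdsWithin_le_nhds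
      exact Continuous.tendsto (by fun_prop) 0
    have hlt : ‖of T₁.form w‖ ^ 2 - (1 + 0) * ‖(w : H)‖ ^ 2 < b := by
      rw [norm_sq_of]
      linarith [hr.2]
    filter_upwards [self_mem_nhdsWithin, hc.eventually_lt_const hlt] with x hx hxb
    exact (bt.quad_le hx hv).trans_lt hxb

theorem tendsto_weylOp_zero (he : ExtremalPair S T₀ T₁) (g : K) :
    Tendsto (fun x : ℝ => bt.weylOp (x : ℂ) g) (𝓝[<] 0) (𝓝 0) := by
  have h1 : Tendsto (fun x : ℝ => √(‖bt.gamma‖ ^ 2 * bt.quad x g)) (𝓝[<] 0) (𝓝 0) := by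
    have := ((bt.tendsto_quad_zero he g).const_mul (‖bt.gamma‖ ^ 2)).sqrt
    simpa using this
  refine squeeze_zero_norm' ?_ h1
  filter_upwards [Ioo_mem_nhdsLT (show (-1 : ℝ) < 0 by norm_num)] with x hx
  exact Real.le_sqrt_of_sq_le
    (bt.norm_sq_weylOp_le hx.2 (bt.quad_le_of_neg_one_le hx.2 hx.1.le) g)

-- Dual to the injectivity of `embed`.
omit [CompleteSpace K] in
theorem denseRange_adjoint_embed (t : ClosedForm H) :
    DenseRange (ContinuousLinearMap.adjoint (embed t)) := by
  have h : (LinearMap.range (ContinuousLinearMap.adjoint (embed t) : H →ₗ[ℂ] FormSpace t)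
      ).topologicalClosure = ⊤ := by
    rw [Submodule.topologicalClosure_eq_top_iff, Submodule.eq_bot_iff]
    intro v hv
    refine embed_injective (ext_inner_left ℂ fun f => ?_)
    rw [map_zero, inner_zero_right, ← ContinuousLinearMap.adjoint_inner_left]
    exact (Submodule.mem_orthogonal _ _).mp hv _ ⟨f, rfl⟩
  exact Submodule.dense_iff_topologicalClosure_eq_top.mpr h

/-- A bounded energy would push u to 0 in H as x → -∞. Since trace*g is approximated by vectors J*f,
the constant ‖g‖² = ⟪trace*g, u⟫ is at most ε‖u‖ + ‖f‖‖Ju‖, which forces the energy to grow. -/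
theorem tendsto_quad_atTop {g : K} (hg : g ≠ 0) :
    Tendsto (fun x : ℝ => bt.quad x g) atBot atTop := by
  refine tendsto_atTop.mpr fun B => ?_
  have hs : 0 < ‖g‖ ^ 2 := by positivity
  have hB : 0 < √(|B| + 1) := Real.sqrt_pos.mpr (by positivity)
  -- Chosen so that ‖g‖⁴ = 4(|B| + 1)ε²; then `h4` gives a quadratic form of at least 2(|B| + 1).
  set ε : ℝ := ‖g‖ ^ 2 / (2 * √(|B| + 1)) with hε
  have hε0 : 0 < ε := by positivity
  obtain ⟨_, hd, f, rfl⟩ := Metric.dense_iff.mp (denseRange_adjoint_embed T₁.form)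
    (ContinuousLinearMap.adjoint bt.trace g) ε hε0
  rw [Metric.mem_ball, dist_comm, dist_eq_norm] at hd
  -- For such x the term ‖f‖²b² is absorbed by the part -(1 + x)b² of the energy, times ε².
  filter_upwards [eventually_le_atBot (-1 - ‖f‖ ^ 2 / ε ^ 2)] with x hx
  have hf0 : 0 ≤ ‖f‖ ^ 2 / ε ^ 2 := by positivity
  have hx0 : x < 0 := by linarith
  have hy : ‖f‖ ^ 2 ≤ -(1 + x) * ε ^ 2 := by
    rw [← div_le_iff₀ (by positivity)]
    linarith
  obtain ⟨u, hu1, hu2⟩ := bt.exists_lift_gammaZ (ofReal_mem_cutPlane hx0) g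
  have hq := bt.quad_eq hx0 hu1 hu2
  set a := ‖u‖
  set b := ‖embed T₁.form u‖
  have h1 : ‖g‖ ^ 2 ≤ ε * a + ‖f‖ * b := by
    have h2 : (⟪g, g⟫_ℂ).re = ‖g‖ ^ 2 := inner_self_eq_norm_sq (𝕜 := ℂ) g
    have h3 : ⟪g, g⟫_ℂ = ⟪ContinuousLinearMap.adjoint bt.trace g -
        ContinuousLinearMap.adjoint (embed T₁.form) f, u⟫_ℂ + ⟪f, embed T₁.form u⟫_ℂ := by
      rw [inner_sub_left, ContinuousLinearMap.adjoint_inner_left,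
        ContinuousLinearMap.adjoint_inner_left, hu2, sub_add_cancel]
    rw [← h2, h3, Complex.add_re]
    refine add_le_add ?_ ?_
    · refine (Complex.re_le_norm _).trans ((norm_inner_le_norm _ _).trans ?_)
      gcongr
    · exact (Complex.re_le_norm _).trans (norm_inner_le_norm _ _)
  have h4 : (‖g‖ ^ 2) ^ 2 ≤ 2 * ε ^ 2 * bt.quad x g := by
    have h5 : (‖g‖ ^ 2) ^ 2 ≤ (ε * a + ‖f‖ * b) ^ 2 := by gcongr
    have h6 : ‖f‖ ^ 2 * b ^ 2 ≤ -(1 + x) * ε ^ 2 * b ^ 2 := by gcongr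
    have h7 : (ε * a + ‖f‖ * b) ^ 2 ≤ 2 * (ε ^ 2 * a ^ 2) + 2 * (‖f‖ ^ 2 * b ^ 2) := by
      nlinarith [sq_nonneg (ε * a - ‖f‖ * b)]
    rw [hq]
    nlinarith
  have h8 : ε ^ 2 = (‖g‖ ^ 2) ^ 2 / (4 * (|B| + 1)) := by
    rw [hε, div_pow, mul_pow, Real.sq_sqrt (by positivity)]
    norm_num
  rw [h8] at h4
  have h9 : (4 * (|B| + 1)) ≤ 2 * bt.quad x g := by
    have h10 : 0 < (‖g‖ ^ 2) ^ 2 := by positivity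
    have h11 : (‖g‖ ^ 2) ^ 2 * (4 * (|B| + 1)) ≤ (‖g‖ ^ 2) ^ 2 * (2 * bt.quad x g) := by
      have := mul_le_mul_of_nonneg_right h4 (by positivity : 0 ≤ 4 * (|B| + 1))
      refine this.trans_eq ?_
      field_simp
    exact le_of_mul_le_mul_left h11 h10
  linarith [le_abs_self B, abs_nonneg B]

/-- D[T₀] is dense in H, so some trial vector v = γg - φ has squared H-norm below b; its energy
divided by -x tends to that squared norm. -/
theorem tendsto_quad_div (g : K) :
    Tendsto (fun x : ℝ => bt.quad x g / -x) atBot (𝓝 0) := by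
  refine tendsto_order.mpr ⟨fun a ha => ?_, fun b hb => ?_⟩
  · filter_upwards [eventually_lt_atBot 0] with x hx
    exact ha.trans_le (div_nonneg (bt.quad_nonneg hx g) (by linarith))
  · have hdense : Dense (T₀.form.dom : Set H) := T₀.selfAdjoint.dense_domain.mono T₀.domain_le
    obtain ⟨φ, hφb, hφ⟩ := Metric.dense_iff.mp hdense (bt.gammaH g) √b (Real.sqrt_pos.mpr hb)
    rw [Metric.mem_ball, dist_comm, dist_eq_norm] at hφb
    have hφ1 : φ ∈ T₁.form.dom := hp.form_restriction.dom_le hφ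
    set v : FormSpace T₁.form := bt.gamma g - of T₁.form ⟨φ, hφ1⟩
    have hv : bt.trace v = g := by
      have h0 : bt.trace (of T₁.form ⟨φ, hφ1⟩) = 0 := bt.trace_eq_zero_iff.mpr hφ
      rw [map_sub, h0, sub_zero, trace_gamma]
    have hvb : ‖embed T₁.form v‖ ^ 2 < b := by
      rw [map_sub, embed_of, ← gammaH_apply, ← Real.sq_sqrt hb.le]
      gcongr
    have hinv : Tendsto (fun x : ℝ => x⁻¹) atBot (𝓝 0) := tendsto_inv_atBot_zero
    have hc : Tendsto (fun x : ℝ => ‖embed T₁.form v‖ ^ 2 -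
        (‖v‖ ^ 2 - ‖embed T₁.form v‖ ^ 2) * x⁻¹) atBot (𝓝 (‖embed T₁.form v‖ ^ 2)) := by
      have := (hinv.const_mul (‖v‖ ^ 2 - ‖embed T₁.form v‖ ^ 2)).const_sub (‖embed T₁.form v‖ ^ 2)
      simpa using this
    filter_upwards [eventually_lt_atBot 0, hc.eventually_lt_const hvb] with x hx hxb
    refine lt_of_le_of_lt ?_ hxb
    rw [div_le_iff₀ (by linarith)]
    refine (bt.quad_le hx hv).trans_eq ?_
    have := hx.ne
    field_simp
    ring

theorem tendsto_inv_smul_weylOp (g : K) :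
    Tendsto (fun x : ℝ => (x : ℂ)⁻¹ • bt.weylOp (x : ℂ) g) atBot (𝓝 0) := by
  have h1 : Tendsto (fun x : ℝ => √(‖bt.gamma‖ ^ 2 * (bt.quad x g / -x))) atBot (𝓝 0) := by
    have := ((bt.tendsto_quad_div g).const_mul (‖bt.gamma‖ ^ 2)).sqrt
    simpa using this
  refine squeeze_zero_norm' ?_ h1
  filter_upwards [eventually_le_atBot (-1)] with x hx
  have hx0 : x < 0 := by linarith
  refine Real.le_sqrt_of_sq_le ?_
  -- The form bound grows only linearly in -x, so division by x² leaves ‖γ‖² times `quad x g / -x`.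
  have h2 := bt.norm_sq_weylOp_le hx0 (bt.quad_le_of_le_neg_one hx) g
  have hx2 : 0 < x ^ 2 := sq_pos_of_neg hx0
  rw [norm_smul, norm_inv, Complex.norm_real, Real.norm_eq_abs, mul_pow, inv_pow, sq_abs,
    inv_mul_le_iff₀ hx2]
  refine h2.trans_eq ?_
  have := hx0.ne
  field_simp

theorem classSF_weylOp (he : ExtremalPair S T₀ T₁) : ClassSF bt.weylOp where
  holomorphic := bt.differentiableOn_weylOp
  symmetric z _ := bt.weylOp_conj z
  im_nonneg z hz g := bt.im_inner_weylOp_nonneg hz g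
  isUnit z hz := bt.isUnit_weylOp hz
  tendsto_zero g := bt.tendsto_weylOp_zero he g
  tendsto_atBot g hg := by
    refine (tendsto_neg_atTop_atBot.comp (bt.tendsto_quad_atTop hg)).congr fun x => ?_
    rw [Function.comp_apply, quad, neg_neg]
    exact inner_re_symm (𝕜 := ℂ) _ _
  tendsto_inv_smul g := bt.tendsto_inv_smul_weylOp g

end BoundaryTriplet

end NonnegTriplet

end

/-! ### Assembly of the theorem -/

open NonnegTriplet
theorem theorem7 {H : Type*} [NormedAddCommGroup H] [InnerProductSpace ℂ H] [CompleteSpace H]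
    {K : Type*} [NormedAddCommGroup K] [InnerProductSpace ℂ K] [CompleteSpace K]
    (S : H →ₗ.[ℂ] H) (T₀ T₁ : NonnegSAOp H) (hp : SpecialPair S T₀ T₁)
    (bt : BoundaryTriplet hp K) :
    ∃ M : ℂ → K →L[ℂ] K,
      (∀ z ∈ cutPlane, Function.Bijective (bt.Γ₀res z) ∧ ∀ h : K, M z h = bt.weyl z h) ∧
      (∃ X₀ : K ≃L[ℂ] defectSpace S (-1),
        ∀ h : K, (bt.gammaField (-1) h : H) = rootDiff T₀ T₁ (X₀ h)) ∧
      (∀ X₀ : K ≃L[ℂ] defectSpace S (-1),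
        (∀ h : K, (bt.gammaField (-1) h : H) = rootDiff T₀ T₁ (X₀ h)) →
        (∀ z ∈ cutPlane, z ≠ -1 →
          IsUnit (T₀.cayley - ((1 - z) / (1 + z)) • (1 : H →L[ℂ] H)) ∧
          M z = (-2 : ℂ) •
            (ContinuousLinearMap.adjoint ((defectSpace S (-1)).subtypeL ∘L (X₀ : K →L[ℂ] _)) ∘L
              qOperator T₀ T₁ ((1 - z) / (1 + z)) ∘L
                ((defectSpace S (-1)).subtypeL ∘L (X₀ : K →L[ℂ] _))) ∧
          M z = (-2 : ℂ) •
            (ContinuousLinearMap.adjoint (X₀ : K →L[ℂ] defectSpace S (-1)) ∘L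
              qFunction hp ((1 - z) / (1 + z)) ∘L (X₀ : K →L[ℂ] defectSpace S (-1)))) ∧
        M (-1) = (-2 : ℂ) •
          (ContinuousLinearMap.adjoint (X₀ : K →L[ℂ] defectSpace S (-1)) ∘L
            (X₀ : K →L[ℂ] defectSpace S (-1)))) ∧
      (ExtremalPair S T₀ T₁ → ClassSF M) := by
  have hg : ∀ h : K, (bt.gammaField (-1) h : H) = bt.gammaH h := fun h => by
    rw [bt.gammaField_eq neg_one_mem_cutPlane, ← bt.gammaZ_neg_one]
  refine ⟨bt.weylOp, fun z hz => ⟨bt.Γ₀res_bijective hz, bt.weylOp_apply hz⟩, ?_,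
    fun X₀ hX => ?_, bt.classSF_weylOp⟩
  · obtain ⟨X₀, hX⟩ := bt.exists_equiv
    exact ⟨X₀, fun h => (hg h).trans (hX h).symm⟩
  · have hX' : ∀ h, rootDiff T₀ T₁ (X₀ h) = bt.gammaH h := fun h => (hX h).symm.trans (hg h)
    exact ⟨fun z hz hz1 => ⟨NonnegSAOp.isUnit_cayley_sub_smul hz hz1,
      bt.weylOp_eq_qOperator hX' hz hz1, bt.weylOp_eq_qFunction hX' hz hz1⟩,
      bt.weylOp_neg_one hX'⟩
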